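/- All algebras are over $\mathbb C$, associative, not necessarily unital, with non-degenerate product ($ab=0$ for all $b$, or $ba=0$ for all $b$, implies $a=0$). $M(A)$ denotes the multiplier algebra of $A$. A multiplier Hopf algebra is a pair $(A,\Delta)$ where $\Delta:A\to M(A\otimes A)$ is an algebra homomorphism such that $\Delta(a)(1\otimes b)$ and $(a\otimes 1)\Delta(b)$ lie in $A\otimes A$ for all $a,b\in A$, such that $$(a\otimes1\otimes1)\,(\Delta\otimes\iota)(\Delta(b)(1\otimes c))=(\iota\otimes\Delta)((a\otimes1)\Delta(b))\,(1\otimes1\otimes c)\qquad(a,b,c\in A),$$ and such that $a\otimes b\mapsto\Delta(a)(1\otimes b)$ and $a\otimes b\mapsto(a\otimes1)\Delta(b)$ define bijections of $A\otimes A$. It is regular if $(A,\Delta^{\mathrm{op}})$, with $\Delta^{\mathrm{op}}$ the composition of $\Delta$ with the flip, is a multiplier Hopf algebra too. The counit is the (unique) homomorphism $\varepsilon:A\to\mathbb C$ with $(\varepsilon\otimes\iota)(\Delta(a)(1\otimes b))=ab=(\iota\otimes\varepsilon)((a\otimes 1)\Delta(b))$ for all $a,b\in A$. A left cointegral of $(A,\Delta)$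 is a non-zero $h\in A$ with $ah=\varepsilon(a)h$ for all $a\in A$, and $(A,\Delta)$ is of discrete type if it has a left cointegral. For a group $G$ with identity $e$, $(A,\Delta)$ is $G$-cograded if there are non-zero subalgebras $(A_p)_{p\in G}$ with $A=\bigoplus_{p\in G}A_p$, $A_pA_q=0$ for $p\neq q$, and $\Delta(A_{pq})(1\otimes A_q)=A_p\otimes A_q=(A_p\otimes 1)\Delta(A_{pq})$ for all $p,q\in G$ (products of subspaces being linear spans). **Proposition 3.3.** Let $(A,\Delta)$ be a regular $G$-cograded multiplier Hopf algebra all of whose components $A_p$ are finite-dimensional and unital, and let $1_e$ be the identity of $A_e$. Then $(A,\Delta)$ is a multiplier Hopf algebra of discrete type. More precisely, $A_e$ with the comultiplication $\Delta_{e,e}:A_e\to A_e\otimes A_e$, $\Delta_{e,e}(a)=\Delta(a)(1_e\otimes 1_e)$, is a finite-dimensional Hopf algebra; it has a left cointegral, that is, a non-zero $h\in A_e$ with $ah=\varepsilon_e(a)h$ for all $a\in A_e$, where $\varepsilon_e$ is its counit; and every left cointegral of $(A_e,\Delta_{e,e})$ is a left cointegral of $(A,\Delta)$. -/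

import Mathlib

open scoped TensorProduct

noncomputable section

namespace MultiplierHopf

section Multipliers

variable (A : Type*) [NonUnitalRing A] [Module ℂ A] [IsScalarTower ℂ A A] [SMulCommClass ℂ A A]

/-- The (algebraic) multiplier algebra `M(A)`: pairs `(l, r)` of linear maps of `A`, to be read as
`l a = m a` and `r a = a m`, where `l` is a left multiplier, `r` is a right multiplier and
`(a m) b = a (m b)`. The product is `(l, r) (l', r') = (l ∘ l', r' ∘ r)`. -/
def multiplierAlgebra : Subalgebra ℂ (Module.End ℂ A × (Module.End ℂ A)ᵐᵒᵖ) where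
  carrier := {m | (∀ a b, m.1 (a * b) = m.1 a * b) ∧
    (∀ a b, m.2.unop (a * b) = a * m.2.unop b) ∧
    (∀ a b, m.2.unop a * b = a * m.1 b)}
  mul_mem' := by
    rintro ⟨l, r⟩ ⟨l', r'⟩ ⟨h1, h2, h3⟩ ⟨h1', h2', h3'⟩
    refine ⟨fun a b => ?_, fun a b => ?_, fun a b => ?_⟩ <;> simp_all
  add_mem' := by
    rintro ⟨l, r⟩ ⟨l', r'⟩ ⟨h1, h2, h3⟩ ⟨h1', h2', h3'⟩
    refine ⟨fun a b => ?_, fun a b => ?_, fun a b => ?_⟩ <;> simp_all [add_mul, mul_add]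
  algebraMap_mem' := by
    intro c
    refine ⟨fun a b => ?_, fun a b => ?_, fun a b => ?_⟩ <;>
      simp [Module.algebraMap_end_apply, smul_mul_assoc, mul_smul_comm]

/-- The multiplier algebra `M(A)` as a type. -/
def Multiplier : Type _ := multiplierAlgebra A

instance : Ring (Multiplier A) := inferInstanceAs (Ring (multiplierAlgebra A))

instance : Algebra ℂ (Multiplier A) := inferInstanceAs (Algebra ℂ (multiplierAlgebra A))

variable {A}

/-- The map `a ↦ m a`. -/
def Multiplier.left (m : Multiplier A) : A →ₗ[ℂ] A := m.1.1

/-- The map `a ↦ a m`. -/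
def Multiplier.right (m : Multiplier A) : A →ₗ[ℂ] A := m.1.2.unop

/-- The canonical map `A → M(A)`. -/
def Multiplier.of : A →ₗ[ℂ] Multiplier A where
  toFun a := ⟨(LinearMap.mulLeft ℂ a, MulOpposite.op (LinearMap.mulRight ℂ a)),
    by refine ⟨fun x y => ?_, fun x y => ?_, fun x y => ?_⟩ <;> simp [mul_assoc]⟩
  map_add' a b := by
    apply Subtype.ext
    refine Prod.ext (LinearMap.ext fun x => ?_)
      (MulOpposite.unop_injective (LinearMap.ext fun x => ?_))
    · exact add_mul a b x
    · exact mul_add x a b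
  map_smul' c a := by
    apply Subtype.ext
    refine Prod.ext (LinearMap.ext fun x => ?_)
      (MulOpposite.unop_injective (LinearMap.ext fun x => ?_))
    · exact smul_mul_assoc c a x
    · exact mul_smul_comm c x a

variable {B : Type*} [NonUnitalRing B] [Module ℂ B] [IsScalarTower ℂ B B] [SMulCommClass ℂ B B]

/-- The canonical map `M(A) × M(B) → M(A ⊗ B)`, `(m, n) ↦ m ⊗ n`. -/
def Multiplier.tensor : Multiplier A →ₗ[ℂ] Multiplier B →ₗ[ℂ] Multiplier (A ⊗[ℂ] B) :=
  LinearMap.mk₂ ℂ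
    (fun m n => ⟨(TensorProduct.map m.left n.left,
        MulOpposite.op (TensorProduct.map m.right n.right)), by
      obtain ⟨⟨l, r⟩, h1, h2, h3⟩ := m
      obtain ⟨⟨l', r'⟩, h1', h2', h3'⟩ := n
      refine ⟨fun x y => ?_, fun x y => ?_, fun x y => ?_⟩ <;>
      · induction x using TensorProduct.induction_on with
        | zero => simp
        | add x x' hx hx' => simp_all [add_mul]
        | tmul a b =>
          induction y using TensorProduct.induction_on with
          | zero => simp
          | add y y' hy hy' => simp_all [mul_add]
          | tmul a' b' => simp_all [Multiplier.left, Multiplier.right]⟩)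
    (fun m m' n => Subtype.ext (Prod.ext (TensorProduct.map_add_left _ _ _)
      (MulOpposite.unop_injective (TensorProduct.map_add_left _ _ _))))
    (fun c m n => Subtype.ext (Prod.ext (TensorProduct.map_smul_left _ _ _)
      (MulOpposite.unop_injective (TensorProduct.map_smul_left _ _ _))))
    (fun m n n' => Subtype.ext (Prod.ext (TensorProduct.map_add_right _ _ _)
      (MulOpposite.unop_injective (TensorProduct.map_add_right _ _ _))))
    (fun c m n => Subtype.ext (Prod.ext (TensorProduct.map_smul_right _ _ _)
      (MulOpposite.unop_injective (TensorProduct.map_smul_right _ _ _))))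

/-- Transport of multipliers along an isomorphism of algebras `f : A ≃ B`. -/
def Multiplier.transport (f : A ≃ₗ[ℂ] B) (hf : ∀ x y, f (x * y) = f x * f y) :
    Multiplier A →ₙₐ[ℂ] Multiplier B where
  toFun m := ⟨(f.conj m.left, MulOpposite.op (f.conj m.right)), by
    have hf' : ∀ x y, f.symm (x * y) = f.symm x * f.symm y := fun x y => by
      rw [LinearEquiv.symm_apply_eq, hf]; simp
    obtain ⟨⟨l, r⟩, h1, h2, h3⟩ := m
    refine ⟨fun x y => ?_, fun x y => ?_, fun x y => ?_⟩
    · simp_all [Multiplier.left, LinearEquiv.conj_apply]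
    · simp_all [Multiplier.right, LinearEquiv.conj_apply]
    · apply f.symm.injective
      simp_all [Multiplier.left, Multiplier.right, LinearEquiv.conj_apply]⟩
  map_smul' c m := Subtype.ext (Prod.ext (map_smul f.conj c m.left)
    (MulOpposite.unop_injective (map_smul f.conj c m.right)))
  map_zero' := Subtype.ext (Prod.ext (map_zero f.conj)
    (MulOpposite.unop_injective (map_zero f.conj)))
  map_add' m n := Subtype.ext (Prod.ext (map_add f.conj m.left n.left)
    (MulOpposite.unop_injective (map_add f.conj m.right n.right)))
  map_mul' m n := Subtype.ext (Prod.ext (LinearEquiv.conj_comp f n.left m.left)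
    (MulOpposite.unop_injective (LinearEquiv.conj_comp f m.right n.right)))

end Multipliers

section Coproducts

variable {A : Type*} [NonUnitalRing A] [Module ℂ A] [IsScalarTower ℂ A A] [SMulCommClass ℂ A A]

theorem comm_mul (x y : A ⊗[ℂ] A) : TensorProduct.comm ℂ A A (x * y) =
    TensorProduct.comm ℂ A A x * TensorProduct.comm ℂ A A y := by
  induction x using TensorProduct.induction_on with
  | zero => simp
  | add x x' hx hx' => simp_all [add_mul]
  | tmul a b =>
    induction y using TensorProduct.induction_on with
    | zero => simp
    | add y y' hy hy' => simp_all [mul_add]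
    | tmul a' b' => simp

theorem assoc_symm_mul (x y : A ⊗[ℂ] (A ⊗[ℂ] A)) : (TensorProduct.assoc ℂ A A A).symm (x * y) =
    (TensorProduct.assoc ℂ A A A).symm x * (TensorProduct.assoc ℂ A A A).symm y := by
  induction x using TensorProduct.induction_on with
  | zero => simp
  | add x x' hx hx' => simp_all [add_mul]
  | tmul a u =>
    induction y using TensorProduct.induction_on with
    | zero => simp
    | add y y' hy hy' => simp_all [mul_add]
    | tmul a' v =>
      induction u using TensorProduct.induction_on with
      | zero => simp
      | add u u' hu hu' => simp_all [add_mul, TensorProduct.tmul_add]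
      | tmul b c =>
        induction v using TensorProduct.induction_on with
        | zero => simp
        | add v v' hv hv' => simp_all [mul_add, TensorProduct.tmul_add]
        | tmul b' c' => simp

variable (A) in
/-- The isomorphism `M(A ⊗ (A ⊗ A)) → M((A ⊗ A) ⊗ A)` given by reassociating brackets. -/
def reassoc : Multiplier (A ⊗[ℂ] (A ⊗[ℂ] A)) →ₙₐ[ℂ] Multiplier ((A ⊗[ℂ] A) ⊗[ℂ] A) :=
  Multiplier.transport (A := A ⊗[ℂ] (A ⊗[ℂ] A)) (B := (A ⊗[ℂ] A) ⊗[ℂ] A)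
    (TensorProduct.assoc ℂ A A A).symm assoc_symm_mul

/-- `1 ⊗ b` as an element of `M(A ⊗ A)`. -/
def oneTmul : A →ₗ[ℂ] Multiplier (A ⊗[ℂ] A) :=
  (Multiplier.tensor (1 : Multiplier A)) ∘ₗ Multiplier.of

/-- `a ⊗ 1` as an element of `M(A ⊗ A)`. -/
def tmulOne : A →ₗ[ℂ] Multiplier (A ⊗[ℂ] A) :=
  (Multiplier.tensor.flip (1 : Multiplier A)) ∘ₗ Multiplier.of

/-- `Δ ⊗ ι : A ⊗ A → M(A ⊗ A ⊗ A)`. -/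
def comulTensorId (Δ : A →ₙₐ[ℂ] Multiplier (A ⊗[ℂ] A)) :
    A ⊗[ℂ] A →ₗ[ℂ] Multiplier ((A ⊗[ℂ] A) ⊗[ℂ] A) :=
  TensorProduct.lift (Multiplier.tensor.compl₁₂ (Δ : A →ₗ[ℂ] Multiplier (A ⊗[ℂ] A)) Multiplier.of)

/-- `ι ⊗ Δ : A ⊗ A → M(A ⊗ A ⊗ A)`. -/
def idTensorComul (Δ : A →ₙₐ[ℂ] Multiplier (A ⊗[ℂ] A)) :
    A ⊗[ℂ] A →ₗ[ℂ] Multiplier (A ⊗[ℂ] (A ⊗[ℂ] A)) :=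
  TensorProduct.lift (Multiplier.tensor.compl₁₂ Multiplier.of (Δ : A →ₗ[ℂ] Multiplier (A ⊗[ℂ] A)))

/-- A comultiplication on `A`: a homomorphism `Δ : A → M(A ⊗ A)` such that `Δ(a)(1 ⊗ b)` and
`(a ⊗ 1)Δ(b)` lie in `A ⊗ A`, and which is coassociative in the sense that
`(a ⊗ 1 ⊗ 1) (Δ ⊗ ι)(Δ(b)(1 ⊗ c)) = (ι ⊗ Δ)((a ⊗ 1)Δ(b)) (1 ⊗ 1 ⊗ c)` in `M(A ⊗ A ⊗ A)`. -/
structure IsComultiplication (Δ : A →ₙₐ[ℂ] Multiplier (A ⊗[ℂ] A)) : Prop where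
  comul_mul_mem : ∀ a b, ∃ x : A ⊗[ℂ] A, Multiplier.of x = Δ a * oneTmul b
  mul_comul_mem : ∀ a b, ∃ x : A ⊗[ℂ] A, Multiplier.of x = tmulOne a * Δ b
  coassoc : ∀ (a b c : A) (x y : A ⊗[ℂ] A),
    Multiplier.of x = Δ b * oneTmul c → Multiplier.of y = tmulOne a * Δ b →
    Multiplier.tensor (tmulOne a) (1 : Multiplier A) * comulTensorId Δ x =
      reassoc A (idTensorComul Δ y * Multiplier.tensor (1 : Multiplier A) (oneTmul c))

/-- `(A, Δ)` is a multiplier Hopf algebra: the product of `A` is non-degenerate, `Δ` is a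
comultiplication, and the maps `a ⊗ b ↦ Δ(a)(1 ⊗ b)` and `a ⊗ b ↦ (a ⊗ 1)Δ(b)` are bijections
from `A ⊗ A` to itself. -/
structure IsMultiplierHopfAlgebra (Δ : A →ₙₐ[ℂ] Multiplier (A ⊗[ℂ] A)) : Prop
    extends IsComultiplication Δ where
  eq_zero_of_mul_right : ∀ a : A, (∀ b, a * b = 0) → a = 0
  eq_zero_of_mul_left : ∀ a : A, (∀ b, b * a = 0) → a = 0
  bijective_left : ∃ T : A ⊗[ℂ] A ≃ₗ[ℂ] A ⊗[ℂ] A,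
    ∀ a b, Multiplier.of (T (a ⊗ₜ[ℂ] b)) = Δ a * oneTmul b
  bijective_right : ∃ T : A ⊗[ℂ] A ≃ₗ[ℂ] A ⊗[ℂ] A,
    ∀ a b, Multiplier.of (T (a ⊗ₜ[ℂ] b)) = tmulOne a * Δ b

/-- The opposite comultiplication, obtained by applying the flip of `A ⊗ A`. -/
def comulOp (Δ : A →ₙₐ[ℂ] Multiplier (A ⊗[ℂ] A)) : A →ₙₐ[ℂ] Multiplier (A ⊗[ℂ] A) :=
  (Multiplier.transport (TensorProduct.comm ℂ A A) comm_mul).comp Δ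

/-- A multiplier Hopf algebra is regular if `(A, Δᵒᵖ)` is a multiplier Hopf algebra as well. -/
structure IsRegularMultiplierHopfAlgebra (Δ : A →ₙₐ[ℂ] Multiplier (A ⊗[ℂ] A)) : Prop
    extends IsMultiplierHopfAlgebra Δ where
  op : IsMultiplierHopfAlgebra (comulOp Δ)

/-- `ε` is the counit of `(A, Δ)`: a homomorphism with `(ε ⊗ ι)(Δ(a)(1 ⊗ b)) = a b` and
`(ι ⊗ ε)((a ⊗ 1)Δ(b)) = a b`. -/
structure IsCounit (Δ : A →ₙₐ[ℂ] Multiplier (A ⊗[ℂ] A)) (ε : A →ₙₐ[ℂ] ℂ) : Prop where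
  left : ∀ a b, ∃ x : A ⊗[ℂ] A, Multiplier.of x = Δ a * oneTmul b ∧
    TensorProduct.lid ℂ A (LinearMap.rTensor A (ε : A →ₗ[ℂ] ℂ) x) = a * b
  right : ∀ a b, ∃ x : A ⊗[ℂ] A, Multiplier.of x = tmulOne a * Δ b ∧
    TensorProduct.rid ℂ A (LinearMap.lTensor A (ε : A →ₗ[ℂ] ℂ) x) = a * b

/-- A left cointegral of `(A, Δ)`: a non-zero `h` with `a h = ε(a) h` for all `a`, where `ε` is the
counit (which is unique on a multiplier Hopf algebra). -/
def IsLeftCointegral (Δ : A →ₙₐ[ℂ] Multiplier (A ⊗[ℂ] A)) (h : A) : Prop :=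
  h ≠ 0 ∧ ∃ ε : A →ₙₐ[ℂ] ℂ, IsCounit Δ ε ∧ ∀ a, a * h = ε a • h

/-- `(A, Δ)` is a multiplier Hopf algebra of discrete type. -/
structure IsDiscreteType (Δ : A →ₙₐ[ℂ] Multiplier (A ⊗[ℂ] A)) : Prop
    extends IsMultiplierHopfAlgebra Δ where
  exists_cointegral : ∃ h, IsLeftCointegral Δ h

/-- `(A, Δ)` is `G`-cograded by the family `𝒜` of non-trivial subalgebras: `A` is the direct sum of
the `𝒜 p`, distinct components annihilate each other, `Δ(𝒜 (pq))(1 ⊗ 𝒜 q) = 𝒜 p ⊗ 𝒜 q` and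
`(𝒜 p ⊗ 1)Δ(𝒜 (pq)) = 𝒜 p ⊗ 𝒜 q`. Products of subspaces are linear spans, and the last two
equalities are read in `M(A ⊗ A)`. -/
structure IsCograded {G : Type*} [Group G] (Δ : A →ₙₐ[ℂ] Multiplier (A ⊗[ℂ] A))
    (𝒜 : G → NonUnitalSubalgebra ℂ A) : Prop where
  ne_bot : ∀ p, 𝒜 p ≠ ⊥
  indep : iSupIndep fun p => (𝒜 p).toSubmodule
  iSup_eq_top : ⨆ p, (𝒜 p).toSubmodule = ⊤
  mul_eq_zero : ∀ p q, p ≠ q → ∀ a ∈ 𝒜 p, ∀ b ∈ 𝒜 q, a * b = 0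
  comul_mul : ∀ p q,
    (𝒜 (p * q)).toSubmodule.map (Δ : A →ₗ[ℂ] Multiplier (A ⊗[ℂ] A)) *
        (𝒜 q).toSubmodule.map oneTmul =
      (LinearMap.range (TensorProduct.mapIncl (𝒜 p).toSubmodule (𝒜 q).toSubmodule)).map
        Multiplier.of
  mul_comul : ∀ p q,
    (𝒜 p).toSubmodule.map tmulOne *
        (𝒜 (p * q)).toSubmodule.map (Δ : A →ₗ[ℂ] Multiplier (A ⊗[ℂ] A)) =
      (LinearMap.range (TensorProduct.mapIncl (𝒜 p).toSubmodule (𝒜 q).toSubmodule)).map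
        Multiplier.of

end Coproducts

section Components

variable {A : Type*} [NonUnitalRing A] [Module ℂ A] [IsScalarTower ℂ A A] [SMulCommClass ℂ A A]

/-- `u` is the identity of the subalgebra `B`. -/
def IsIdentity (B : NonUnitalSubalgebra ℂ A) (u : B) : Prop := ∀ b : B, u * b = b ∧ b * u = b

/-- The subalgebra `B`, seen as a ring with identity `u`. -/
def UnitalSub (B : NonUnitalSubalgebra ℂ A) (u : B) (_hu : IsIdentity B u) : Type _ := B

variable {B : NonUnitalSubalgebra ℂ A} {u : B} {hu : IsIdentity B u}

instance : Ring (UnitalSub B u hu) :=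
  { (inferInstance : NonUnitalRing B) with
    one := u
    one_mul := fun b => (hu b).1
    mul_one := fun b => (hu b).2 }

/-- The underlying element of `A`. -/
def UnitalSub.val (b : UnitalSub B u hu) : A := Subtype.val (p := (· ∈ B)) b

/-- The given Hopf algebra structure on `B` has the scalar multiplication of `A`, and its
comultiplication is the component `b ↦ Δ(b)(u ⊗ u)` of `Δ`, viewed in `B ⊗ B ⊆ A ⊗ A`.
The map `j` is the inclusion `B ⊆ A`, linear for the scalar multiplication of the Hopf algebra. -/
def IsComponentHopfAlgebra (Δ : A →ₙₐ[ℂ] Multiplier (A ⊗[ℂ] A))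
    (B : NonUnitalSubalgebra ℂ A) (u : B) (hu : IsIdentity B u)
    [HopfAlgebra ℂ (UnitalSub B u hu)] : Prop :=
  ∃ j : UnitalSub B u hu →ₗ[ℂ] A, (∀ b, j b = b.val) ∧
    ∀ b, Multiplier.of (TensorProduct.map j j (Coalgebra.comul (R := ℂ) b)) =
      Δ b.val * Multiplier.of ((u : A) ⊗ₜ[ℂ] (u : A))

end Components

/-- A left cointegral of a Hopf algebra. -/
def IsHopfLeftCointegral {H : Type*} [Ring H] [HopfAlgebra ℂ H] (h : H) : Prop :=
  h ≠ 0 ∧ ∀ a : H, a * h = Coalgebra.counit (R := ℂ) a • h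

end MultiplierHopf

end

open MultiplierHopf

/-! Write Δ_{p,q}(a) = Δ(a)(1_p ⊗ 1_q). The identities 1_p are central idempotents of A, and the
grading makes Δ_{p,q} see only the component of its argument in A_{pq}. Cutting the coassociativity
of Δ by 1_p ⊗ 1_q ⊗ 1_r therefore gives honest identities in A ⊗ A ⊗ A between the Δ_{p,q}
(`comulAt_coassoc`).

For p = q = e, the grading condition says that a ⊗ b ↦ Δ(a)(1 ⊗ b) and a ⊗ b ↦ (a ⊗ 1)Δ(b) are onto
A_e ⊗ A_e; the first is then bijective by finite dimension. A unital algebra with such a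
coassociative multiplicative map is a Hopf algebra: if T is the first map, then ε(a)1 = m T⁻¹(a ⊗ 1)
and S(a) = (ε ⊗ ι)T⁻¹(a ⊗ 1) (`IsGaloisComul.hopfAlgebra`).

A cointegral of a finite-dimensional Hopf algebra is a partial trace. For each w, tracing y ↦ y₁ ⊗
S²(y₂)w over the second leg gives h_w with a h_w = ε(a) h_w; the trace of w ↦ S(h_w) is 1, so some
h_w is non-zero. Bijectivity of S is not needed.

Finally ε_e, extended by zero to the other components, is the counit of (A, Δ)
(`isCounit_extendChar`). For h in A_e one has ah = (a 1_e)h = ε_e(a 1_e)h = ε(a)h, so a cointegral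
of A_e is one of A. -/

set_option linter.unusedSectionVars false

open scoped TensorProduct

noncomputable section

namespace MultiplierHopf

/-! ### Hopf algebras from bijectivity of the Galois maps -/

section Galois

variable {k H : Type*} [Field k] [Ring H] [Algebra k H]

/-- The map `a ⊗ b ↦ δ(a)(1 ⊗ b)`. -/
def galoisLeft (δ : H →ₗ[k] H ⊗[k] H) : H ⊗[k] H →ₗ[k] H ⊗[k] H :=
  TensorProduct.lift ((LinearMap.mul k (H ⊗[k] H)).compl₁₂ δ (TensorProduct.mk k H H 1))

/-- The map `a ⊗ b ↦ (a ⊗ 1)δ(b)`. -/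
def galoisRight (δ : H →ₗ[k] H ⊗[k] H) : H ⊗[k] H →ₗ[k] H ⊗[k] H :=
  TensorProduct.lift
    ((LinearMap.mul k (H ⊗[k] H)).compl₁₂ ((TensorProduct.mk k H H).flip 1) δ)

@[simp]
theorem galoisLeft_tmul (δ : H →ₗ[k] H ⊗[k] H) (a b : H) :
    galoisLeft δ (a ⊗ₜ b) = δ a * (1 ⊗ₜ b) := by simp [galoisLeft]

@[simp]
theorem galoisRight_tmul (δ : H →ₗ[k] H ⊗[k] H) (a b : H) :
    galoisRight δ (a ⊗ₜ b) = (a ⊗ₜ 1) * δ b := by simp [galoisRight]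

/-- A multiplicative coassociative map `δ : H → H ⊗ H` for which `a ⊗ b ↦ δ(a)(1 ⊗ b)` is
bijective and `a ⊗ b ↦ (a ⊗ 1)δ(b)` is surjective. -/
structure IsGaloisComul (δ : H →ₗ[k] H ⊗[k] H) : Prop where
  map_mul : ∀ a b, δ (a * b) = δ a * δ b
  coassoc : TensorProduct.assoc k H H H ∘ₗ δ.rTensor H ∘ₗ δ = δ.lTensor H ∘ₗ δ
  bijective_left : Function.Bijective (galoisLeft δ)
  surjective_right : Function.Surjective (galoisRight δ)

theorem galoisLeft_mul (δ : H →ₗ[k] H ⊗[k] H) (x : H ⊗[k] H) (b : H) :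
    galoisLeft δ (x * (1 ⊗ₜ b)) = galoisLeft δ x * (1 ⊗ₜ b) := by
  induction x using TensorProduct.induction_on with
  | zero => simp
  | add x y hx hy => simp [add_mul, hx, hy]
  | tmul a c => simp [mul_assoc]

/-- The map `a ⊗ b ↦ a₁ ⊗ a₂ ⊗ b`. -/
def comulLeft (δ : H →ₗ[k] H ⊗[k] H) : H ⊗[k] H →ₗ[k] H ⊗[k] (H ⊗[k] H) :=
  TensorProduct.assoc k H H H ∘ₗ δ.rTensor H

theorem lTensor_mul_left {f : H →ₗ[k] H} (a : H) (x : H ⊗[k] H) :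
    f.lTensor H ((a ⊗ₜ 1) * x) = (a ⊗ₜ 1) * f.lTensor H x := by
  induction x using TensorProduct.induction_on with
  | zero => simp
  | add x y hx hy => simp [mul_add, hx, hy]
  | tmul b c => simp

theorem rid_lTensor_mul_left (f : H →ₗ[k] k) (a : H) (x : H ⊗[k] H) :
    TensorProduct.rid k H (f.lTensor H ((a ⊗ₜ 1) * x)) =
      a * TensorProduct.rid k H (f.lTensor H x) := by
  induction x using TensorProduct.induction_on with
  | zero => simp
  | add x y hx hy => simp [mul_add, hx, hy]
  | tmul b c => simp

theorem lid_rTensor_mul_right (f : H →ₗ[k] k) (x : H ⊗[k] H) (b : H) :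
    TensorProduct.lid k H (f.rTensor H (x * (1 ⊗ₜ b))) =
      TensorProduct.lid k H (f.rTensor H x) * b := by
  induction x using TensorProduct.induction_on with
  | zero => simp
  | add x y hx hy => simp [add_mul, hx, hy]
  | tmul b c => simp

variable (k) in
theorem exists_dual_eq_one {V : Type*} [AddCommGroup V] [Module k V] {v : V} (hv : v ≠ 0) :
    ∃ f : V →ₗ[k] k, f v = 1 := by
  obtain ⟨f, hf⟩ := (LinearMap.toSpanSingleton k V v).exists_leftInverse_of_injective
    (LinearMap.ker_toSpanSingleton k hv)
  exact ⟨f, by simpa using LinearMap.congr_fun hf 1⟩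

namespace IsGaloisComul

variable {δ : H →ₗ[k] H ⊗[k] H} (h : IsGaloisComul δ)

include h

theorem coassoc_apply (a : H) :
    TensorProduct.assoc k H H H (δ.rTensor H (δ a)) = δ.lTensor H (δ a) :=
  LinearMap.congr_fun h.coassoc a

/-- Multiplication by `δ 1` fixes the range of `galoisLeft δ`, and that range contains 1. -/
theorem map_one : δ 1 = 1 := by
  obtain ⟨z, hz⟩ := h.bijective_left.2 1
  have key : ∀ z, δ 1 * galoisLeft δ z = galoisLeft δ z := by
    intro z
    induction z using TensorProduct.induction_on with
    | zero => simp
    | add x y hx hy => simp [mul_add, hx, hy]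
    | tmul a b => simp [← mul_assoc, ← h.map_mul]
  simpa [hz] using key z

/-- The inverse of `a ⊗ b ↦ δ(a)(1 ⊗ b)`. -/
def galoisInv : H ⊗[k] H →ₗ[k] H ⊗[k] H :=
  (LinearEquiv.ofBijective (galoisLeft δ) h.bijective_left).symm

theorem galoisLeft_galoisInv (x : H ⊗[k] H) : galoisLeft δ (h.galoisInv x) = x :=
  (LinearEquiv.ofBijective (galoisLeft δ) h.bijective_left).apply_symm_apply x

theorem galoisInv_galoisLeft (x : H ⊗[k] H) : h.galoisInv (galoisLeft δ x) = x :=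
  (LinearEquiv.ofBijective (galoisLeft δ) h.bijective_left).symm_apply_apply x

theorem galoisInv_mul (x : H ⊗[k] H) (b : H) :
    h.galoisInv (x * (1 ⊗ₜ b)) = h.galoisInv x * (1 ⊗ₜ b) := by
  apply h.bijective_left.1
  rw [galoisLeft_mul, galoisLeft_galoisInv, galoisLeft_galoisInv]

/-- Both sides send a ⊗ b to a₁ ⊗ a₂ ⊗ a₃b. So T = `galoisLeft δ` commutes with the coproduct on the
first leg, and hence so does T⁻¹; every formula for the counit and the antipode comes from this. -/
theorem lTensor_galoisLeft_comulLeft (z : H ⊗[k] H) :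
    (galoisLeft δ).lTensor H (comulLeft δ z) = comulLeft δ (galoisLeft δ z) := by
  induction z using TensorProduct.induction_on with
  | zero => simp
  | add x y hx hy => simp [hx, hy]
  | tmul a b =>
    have h1 : ∀ x : H ⊗[k] H, (galoisLeft δ).lTensor H (TensorProduct.assoc k H H H (x ⊗ₜ b)) =
        (LinearMap.mulRight k ((1 : H) ⊗ₜ[k] b)).lTensor H (δ.lTensor H x) := by
      intro x
      induction x using TensorProduct.induction_on with
      | zero => simp
      | add x y hx hy => simp [TensorProduct.add_tmul, hx, hy]
      | tmul c d => simp
    have h2 : ∀ x : H ⊗[k] H, comulLeft δ (x * (1 ⊗ₜ b)) =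
        (LinearMap.mulRight k ((1 : H) ⊗ₜ[k] b)).lTensor H
          (TensorProduct.assoc k H H H (δ.rTensor H x)) := by
      intro x
      induction x using TensorProduct.induction_on with
      | zero => simp
      | add x y hx hy => simp [add_mul, hx, hy]
      | tmul c d =>
        simp only [comulLeft, Algebra.TensorProduct.tmul_mul_tmul, mul_one, LinearMap.comp_apply,
          LinearMap.rTensor_tmul, LinearEquiv.coe_coe]
        induction δ c using TensorProduct.induction_on with
        | zero => simp
        | add x y hx hy => simp [TensorProduct.add_tmul, hx, hy]
        | tmul c d => simp
    rw [galoisLeft_tmul, h2, h.coassoc_apply, ← h1]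
    simp [comulLeft]

theorem comulLeft_galoisInv (z : H ⊗[k] H) :
    comulLeft δ (h.galoisInv z) = h.galoisInv.lTensor H (comulLeft δ z) := by
  conv_rhs => rw [← h.galoisLeft_galoisInv z]
  rw [← h.lTensor_galoisLeft_comulLeft, ← LinearMap.lTensor_comp_apply]
  have : h.galoisInv ∘ₗ galoisLeft δ = LinearMap.id := LinearMap.ext h.galoisInv_galoisLeft
  simp [this]

omit h in
theorem lTensor_mul_comulLeft (z : H ⊗[k] H) :
    (LinearMap.mul' k H).lTensor H (comulLeft δ z) = galoisLeft δ z := by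
  induction z using TensorProduct.induction_on with
  | zero => simp
  | add x y hx hy => simp [hx, hy]
  | tmul a b =>
    simp only [comulLeft, LinearMap.comp_apply, LinearMap.rTensor_tmul, LinearEquiv.coe_coe,
      galoisLeft_tmul]
    induction δ a using TensorProduct.induction_on with
    | zero => simp
    | add x y hx hy => simp [TensorProduct.add_tmul, add_mul, hx, hy]
    | tmul c d => simp

omit h in
theorem lTensor_comulLeft_tmul_one (f : H ⊗[k] H →ₗ[k] H) (a : H) :
    f.lTensor H (comulLeft δ (a ⊗ₜ 1)) =
      (f ∘ₗ (TensorProduct.mk k H H).flip 1).lTensor H (δ a) := by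
  simp only [comulLeft, LinearMap.comp_apply, LinearMap.rTensor_tmul, LinearEquiv.coe_coe]
  induction δ a using TensorProduct.induction_on with
  | zero => simp
  | add x y hx hy => simp [TensorProduct.add_tmul, hx, hy]
  | tmul c d => simp

/-- The map `a ↦ ε(a) 1`, where `ε` is the counit. -/
def counitOne : H →ₗ[k] H :=
  LinearMap.mul' k H ∘ₗ h.galoisInv ∘ₗ (TensorProduct.mk k H H).flip 1

/-- Moving T⁻¹ past the coproduct turns the left side into (ι ⊗ m)(δ ⊗ ι)T⁻¹(a ⊗ 1), and (ι ⊗ m)(δ ⊗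
ι) = T. -/
theorem lTensor_counitOne (a : H) : h.counitOne.lTensor H (δ a) = a ⊗ₜ 1 := by
  have := lTensor_comulLeft_tmul_one (δ := δ) (LinearMap.mul' k H ∘ₗ h.galoisInv) a
  rw [LinearMap.comp_assoc] at this
  rw [counitOne, ← this, LinearMap.lTensor_comp_apply, ← comulLeft_galoisInv,
    lTensor_mul_comulLeft, galoisLeft_galoisInv]

/-- Every x is a sum of elements (a ⊗ 1)δ(b), which are sent to ab ⊗ 1. This is what forces the
values of `counitOne` to be scalars. -/
theorem exists_lTensor_counitOne (x : H ⊗[k] H) :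
    ∃ z, h.counitOne.lTensor H x = z ⊗ₜ 1 := by
  obtain ⟨y, rfl⟩ := h.surjective_right x
  induction y using TensorProduct.induction_on with
  | zero => exact ⟨0, by simp⟩
  | add x y hx hy =>
    obtain ⟨z, hz⟩ := hx
    obtain ⟨w, hw⟩ := hy
    exact ⟨z + w, by simp [hz, hw, TensorProduct.add_tmul]⟩
  | tmul a b => exact ⟨a * b, by rw [galoisRight_tmul, lTensor_mul_left, lTensor_counitOne]; simp⟩

theorem exists_counit [Nontrivial H] : ∃ ε : H →ₗ[k] k, ∀ a, h.counitOne a = ε a • 1 := by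
  obtain ⟨f, hf⟩ := exists_dual_eq_one k (one_ne_zero (α := H))
  refine ⟨f ∘ₗ h.counitOne, fun a => ?_⟩
  -- Here 1 ⊗ `counitOne a` = z ⊗ 1; slicing the first leg with f, where f(1) = 1, leaves a multiple
  -- of 1.
  obtain ⟨z, hz⟩ := h.exists_lTensor_counitOne (1 ⊗ₜ a)
  rw [LinearMap.lTensor_tmul] at hz
  have h1 : h.counitOne a = f z • 1 := by
    simpa [hf] using congr(TensorProduct.lid k H (f.rTensor H $hz))
  simp [h1, hf]

variable [Nontrivial H]

/-- The counit determined by a Galois comultiplication. -/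
def counit : H →ₗ[k] k := h.exists_counit.choose

theorem counitOne_apply (a : H) : h.counitOne a = h.counit a • 1 := h.exists_counit.choose_spec a

theorem rid_lTensor_counit (a : H) : TensorProduct.rid k H (h.counit.lTensor H (δ a)) = a := by
  have key : ∀ x : H ⊗[k] H,
      h.counitOne.lTensor H x = TensorProduct.rid k H (h.counit.lTensor H x) ⊗ₜ 1 := by
    intro x
    induction x using TensorProduct.induction_on with
    | zero => simp
    | add x y hx hy => simp [TensorProduct.add_tmul, hx, hy]
    | tmul c d => simp [counitOne_apply, TensorProduct.smul_tmul]
  obtain ⟨f, hf⟩ := exists_dual_eq_one k (one_ne_zero (α := H))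
  have h1 := h.lTensor_counitOne a
  rw [key] at h1
  simpa [hf] using congr(TensorProduct.rid k H (f.lTensor H $h1))

/-- The elements (a ⊗ 1)δ(b) span H ⊗ H, so a linear map can be tested on their second legs. -/
theorem eq_of_lTensor_galoisRight {M : Type*} [AddCommGroup M] [Module k M] {f g : H →ₗ[k] M}
    (hfg : ∀ a b, f.lTensor H ((a ⊗ₜ 1) * δ b) = g.lTensor H ((a ⊗ₜ 1) * δ b)) : f = g := by
  have key : f.lTensor H = g.lTensor H := by
    refine LinearMap.ext fun x => ?_
    obtain ⟨y, rfl⟩ := h.surjective_right x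
    induction y using TensorProduct.induction_on with
    | zero => simp
    | add x y hx hy => simp [hx, hy]
    | tmul a b => simpa using hfg a b
  ext y
  obtain ⟨φ, hφ⟩ := exists_dual_eq_one k (one_ne_zero (α := H))
  simpa [hφ] using congr(TensorProduct.lid k M (φ.rTensor M ($key (1 ⊗ₜ y))))

/-- Tested on second legs, the claim becomes b₁ ⊗ ε(b₂)b₃ = b₁ ⊗ b₂, which is coassociativity and
the other counit law. -/
theorem lid_rTensor_counit (a : H) : TensorProduct.lid k H (h.counit.rTensor H (δ a)) = a := by
  have key : ((TensorProduct.lid k H).toLinearMap ∘ₗ h.counit.rTensor H ∘ₗ δ) = LinearMap.id := by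
    refine h.eq_of_lTensor_galoisRight fun c b => ?_
    rw [lTensor_mul_left, lTensor_mul_left]
    congr 1
    rw [LinearMap.lTensor_comp_apply, LinearMap.lTensor_comp_apply, ← h.coassoc_apply]
    have h1 : ∀ x : H ⊗[k] H, (TensorProduct.lid k H).toLinearMap.lTensor H
        ((h.counit.rTensor H).lTensor H (TensorProduct.assoc k H H H (δ.rTensor H x))) = x := by
      intro x
      induction x using TensorProduct.induction_on with
      | zero => simp
      | add x y hx hy => simp [hx, hy]
      | tmul c d =>
        conv_rhs => rw [← h.rid_lTensor_counit c]
        rw [LinearMap.rTensor_tmul]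
        induction δ c using TensorProduct.induction_on with
        | zero => simp
        | add x y hx hy => simp [TensorProduct.add_tmul, hx, hy]
        | tmul a b => simp [TensorProduct.smul_tmul]
    simp [h1]
  exact LinearMap.congr_fun key a

/-- Writing x as a sum of (c ⊗ 1)δ(d) and using that δ is multiplicative gives (ι ⊗ ε)(x δ(b)) = (ι
⊗ ε)(x) b. Taking x = 1 ⊗ a shows that ε(a ·) and ε(a)ε agree on the second leg of δ(b), and such
legs suffice. -/
theorem counit_mul (a b : H) : h.counit (a * b) = h.counit a * h.counit b := by
  have h1 : ∀ (x : H ⊗[k] H) (b : H), TensorProduct.rid k H (h.counit.lTensor H (x * δ b)) =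
      TensorProduct.rid k H (h.counit.lTensor H x) * b := by
    intro x b
    obtain ⟨y, rfl⟩ := h.surjective_right x
    induction y using TensorProduct.induction_on with
    | zero => simp
    | add x y hx hy => simp [add_mul, hx, hy]
    | tmul c d =>
      rw [galoisRight_tmul, mul_assoc, ← h.map_mul, rid_lTensor_mul_left, rid_lTensor_mul_left,
        rid_lTensor_counit, rid_lTensor_counit, mul_assoc]
  have h2 : ∀ x : H ⊗[k] H, h.counit.lTensor H ((1 ⊗ₜ a) * x) =
      (h.counit ∘ₗ LinearMap.mulLeft k a).lTensor H x := by
    intro x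
    induction x using TensorProduct.induction_on with
    | zero => simp
    | add x y hx hy => simp [mul_add, hx, hy]
    | tmul c d => simp
  have key : h.counit ∘ₗ LinearMap.mulLeft k a = h.counit a • h.counit := by
    refine h.eq_of_lTensor_galoisRight fun c b => ?_
    apply (TensorProduct.rid k H).injective
    rw [rid_lTensor_mul_left, ← h2, h1, rid_lTensor_mul_left, LinearMap.lTensor_smul]
    simp [rid_lTensor_counit]
  exact LinearMap.congr_fun key b

theorem counit_one : h.counit 1 = 1 := by
  obtain ⟨f, hf⟩ := exists_dual_eq_one k (one_ne_zero (α := H))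
  have := h.rid_lTensor_counit 1
  rw [h.map_one, Algebra.TensorProduct.one_def] at this
  simpa [hf] using congr(f $this)

/-- The antipode determined by a Galois comultiplication. -/
def antipode : H →ₗ[k] H :=
  (TensorProduct.lid k H).toLinearMap ∘ₗ h.counit.rTensor H ∘ₗ h.galoisInv ∘ₗ
    (TensorProduct.mk k H H).flip 1

/-- Again T⁻¹ passes the coproduct, and (ι ⊗ ε ⊗ ι)(δ ⊗ ι) is the identity. Applying m yields one
antipode axiom, since m T⁻¹(a ⊗ 1) = ε(a)1 by definition. -/
theorem lTensor_antipode (a : H) : h.antipode.lTensor H (δ a) = h.galoisInv (a ⊗ₜ 1) := by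
  have h1 : ∀ w : H ⊗[k] H, ((TensorProduct.lid k H).toLinearMap ∘ₗ h.counit.rTensor H).lTensor H
      (comulLeft δ w) = w := by
    intro w
    induction w using TensorProduct.induction_on with
    | zero => simp
    | add x y hx hy => rw [map_add, map_add, hx, hy]
    | tmul a b =>
      conv_rhs => rw [← h.rid_lTensor_counit a]
      simp only [comulLeft, LinearMap.comp_apply, LinearMap.rTensor_tmul, LinearEquiv.coe_coe]
      induction δ a using TensorProduct.induction_on with
      | zero => simp
      | add x y hx hy => simp only [TensorProduct.add_tmul, map_add, hx, hy]
      | tmul a b => simp [TensorProduct.smul_tmul]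
  have := lTensor_comulLeft_tmul_one (δ := δ)
    (((TensorProduct.lid k H).toLinearMap ∘ₗ h.counit.rTensor H) ∘ₗ h.galoisInv) a
  rw [LinearMap.comp_assoc, LinearMap.comp_assoc, LinearMap.comp_assoc] at this
  rw [antipode, ← this, ← LinearMap.comp_assoc, LinearMap.lTensor_comp_apply,
    ← comulLeft_galoisInv, h1]

/-- T⁻¹ is right H-linear in the second leg, which reduces to the definition of S. At x = δ(a) = T(a
⊗ 1) this is the other antipode axiom. -/
theorem mul_rTensor_antipode (x : H ⊗[k] H) : LinearMap.mul' k H (h.antipode.rTensor H x) =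
    TensorProduct.lid k H (h.counit.rTensor H (h.galoisInv x)) := by
  induction x using TensorProduct.induction_on with
  | zero => simp
  | add x y hx hy => simp [hx, hy]
  | tmul a b =>
    have : a ⊗ₜ[k] b = (a ⊗ₜ 1) * (1 ⊗ₜ b) := by simp
    rw [this, galoisInv_mul, lid_rTensor_mul_right]
    simp [antipode]

/-- A Galois comultiplication on a non-trivial algebra is that of a Hopf algebra. -/
abbrev hopfAlgebra : HopfAlgebra k H :=
  letI : Coalgebra k H :=
    { comul := δ
      counit := h.counit
      coassoc := h.coassoc
      rTensor_counit_comp_comul := by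
        ext a
        apply (TensorProduct.lid k H).injective
        simp [h.lid_rTensor_counit]
      lTensor_counit_comp_comul := by
        ext a
        apply (TensorProduct.rid k H).injective
        simp [h.rid_lTensor_counit] }
  letI : Bialgebra k H := Bialgebra.mk' k H h.counit_one (h.counit_mul _ _) h.map_one
    (h.map_mul _ _)
  { antipode := h.antipode
    mul_antipode_rTensor_comul := by
      ext a
      change LinearMap.mul' k H (h.antipode.rTensor H (δ a)) = algebraMap k H (h.counit a)
      have : δ a = galoisLeft δ (a ⊗ₜ 1) := by
        rw [galoisLeft_tmul, ← Algebra.TensorProduct.one_def, mul_one]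
      rw [mul_rTensor_antipode, this, galoisInv_galoisLeft]
      simp [Algebra.algebraMap_eq_smul_one]
    mul_antipode_lTensor_comul := by
      ext a
      change LinearMap.mul' k H (h.antipode.lTensor H (δ a)) = algebraMap k H (h.counit a)
      rw [lTensor_antipode, Algebra.algebraMap_eq_smul_one, ← h.counitOne_apply]
      rfl }

end IsGaloisComul

end Galois

/-! ### Partial traces -/

section PartialTrace

variable {k V W ι : Type*} [Field k] [AddCommGroup V] [Module k V] [AddCommGroup W] [Module k W]
  [Fintype ι] (b : Module.Basis ι k V)

/-- The partial trace `∑ᵢ (ι ⊗ bᵢ*)(g(bᵢ))` of a map `g : V → W ⊗ V`. -/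
def partialTrace : (V →ₗ[k] W ⊗[k] V) →ₗ[k] W :=
  ∑ i, (TensorProduct.rid k W).toLinearMap ∘ₗ (b.coord i).lTensor W ∘ₗ LinearMap.applyₗ (b i)

theorem partialTrace_apply (g : V →ₗ[k] W ⊗[k] V) :
    partialTrace b g = ∑ i, TensorProduct.rid k W ((b.coord i).lTensor W (g (b i))) := by
  simp [partialTrace]

/-- Cyclicity of the trace: expanding f in its matrix gives the same double sum on both sides. -/
theorem partialTrace_comp_comm (g : V →ₗ[k] W ⊗[k] V) (f : V →ₗ[k] V) :
    partialTrace b (f.lTensor W ∘ₗ g) = partialTrace b (g ∘ₗ f) := by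
  have h1 : ∀ i, b.coord i ∘ₗ f = ∑ j, b.coord i (f (b j)) • b.coord j := by
    intro i
    classical
    refine b.ext fun l => ?_
    simp [Finsupp.single_apply]
  have h2 : ∀ j, g (f (b j)) = ∑ i, b.coord i (f (b j)) • g (b i) := by
    intro j
    conv_lhs => rw [← b.sum_repr (f (b j)), map_sum]
    exact Finset.sum_congr rfl fun i _ => map_smul g _ _
  have h3 : ∀ (i) (x : W ⊗[k] V), (b.coord i).lTensor W (f.lTensor W x) =
      ∑ j, b.coord i (f (b j)) • (b.coord j).lTensor W x := by
    intro i x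
    rw [← LinearMap.lTensor_comp_apply, h1]
    change LinearMap.lTensorHom W _ x = _
    rw [map_sum, LinearMap.sum_apply]
    exact Finset.sum_congr rfl fun j _ => by rw [map_smul]; rfl
  simp only [partialTrace_apply, LinearMap.comp_apply, h2, h3, map_sum, map_smul]
  exact Finset.sum_comm

theorem map_partialTrace (g : V →ₗ[k] W ⊗[k] V) (f : W →ₗ[k] W) :
    f (partialTrace b g) = partialTrace b (f.rTensor V ∘ₗ g) := by
  simp only [partialTrace_apply, map_sum, LinearMap.comp_apply]
  refine Finset.sum_congr rfl fun i _ => ?_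
  induction g (b i) using TensorProduct.induction_on with
  | zero => simp
  | add x y hx hy => simp [hx, hy]
  | tmul c d => simp

end PartialTrace

/-! ### Cointegrals of finite-dimensional Hopf algebras -/

section Cointegral

open Coalgebra HopfAlgebra

variable {k H : Type*} [Field k] [Ring H] [HopfAlgebra k H]

variable (k) in
/-- The map `y ↦ y₁ ⊗ S²(y₂) w`. -/
def cointegralKernel (w : H) : H →ₗ[k] H ⊗[k] H :=
  (LinearMap.mulRight k w ∘ₗ antipode k ∘ₗ antipode k).lTensor H ∘ₗ comul

/-- In Sweedler notation, a₁ ⊗ S(a₃)S²(a₂) = a₁ ⊗ S(S(a₂)a₃) = a ⊗ 1, because S reverses products.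
-/
theorem tmul_antipode_mul_antipode {a : H} {ι : Type*} (r : Coalgebra.Repr k a ι) :
    ∑ i ∈ r.index, (LinearMap.mulLeft k (antipode k (r.right i)) ∘ₗ antipode k ∘ₗ
      antipode k).lTensor H (comul (r.left i)) = a ⊗ₜ[k] (1 : H) := by
  have h1 : ∀ x : H ⊗[k] H, (antipode k ∘ₗ LinearMap.mul' k H ∘ₗ (antipode k).rTensor H ∘ₗ
      comul).lTensor H x = TensorProduct.rid k H (counit.lTensor H x) ⊗ₜ[k] (1 : H) := by
    intro x
    induction x using TensorProduct.induction_on with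
    | zero => simp
    | add x y hx hy => simp only [map_add, TensorProduct.add_tmul, hx, hy]
    | tmul c d => simp [Algebra.algebraMap_eq_smul_one, TensorProduct.smul_tmul]
  have h2 := h1 (comul a)
  rw [lTensor_counit_comul, TensorProduct.rid_tmul, one_smul, ← LinearMap.comp_assoc,
    ← LinearMap.comp_assoc, LinearMap.lTensor_comp_apply, ← coassoc_apply, ← r.eq] at h2
  rw [← h2]
  simp only [map_sum, LinearMap.rTensor_tmul]
  refine Finset.sum_congr rfl fun i _ => ?_
  induction comul (R := k) (r.left i) using TensorProduct.induction_on with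
  | zero => simp
  | add x y hx hy => simp only [map_add, TensorProduct.add_tmul, hx, hy]
  | tmul c d => simp [antipode_mul_antidistrib]

/-- Inserting the previous identity, ay₁ ⊗ S²(y₂)w = a₁y₁ ⊗ S(a₃)S²(a₂y₂)w: left multiplication by a
is moved onto the argument y and the traced leg. -/
theorem mulLeft_cointegralKernel {a : H} {ι : Type*} (r : Coalgebra.Repr k a ι) (w : H) :
    (LinearMap.mulLeft k a).rTensor H ∘ₗ cointegralKernel k w =
      ∑ i ∈ r.index, (LinearMap.mulLeft k (antipode k (r.right i))).lTensor H ∘ₗ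
        cointegralKernel k w ∘ₗ LinearMap.mulLeft k (r.left i) := by
  ext y
  have key : ∀ x : H ⊗[k] H, (LinearMap.mulLeft k a).rTensor H
      ((LinearMap.mulRight k w ∘ₗ antipode k ∘ₗ antipode k).lTensor H x) =
      ∑ i ∈ r.index, (LinearMap.mulLeft k (antipode k (r.right i))).lTensor H
        ((LinearMap.mulRight k w ∘ₗ antipode k ∘ₗ antipode k).lTensor H
          (comul (r.left i) * x)) := by
    intro x
    induction x using TensorProduct.induction_on with
    | zero => simp
    | add x y hx hy => simp only [map_add, mul_add, hx, hy, Finset.sum_add_distrib]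
    | tmul c d =>
      have h1 := congr($(tmul_antipode_mul_antipode r) * (c ⊗ₜ[k] (antipode k (antipode k d) * w)))
      rw [Finset.sum_mul] at h1
      simp only [LinearMap.lTensor_tmul, LinearMap.rTensor_tmul, LinearMap.comp_apply,
        LinearMap.mulRight_apply, LinearMap.mulLeft_apply]
      rw [Algebra.TensorProduct.tmul_mul_tmul, one_mul] at h1
      rw [← h1]
      refine Finset.sum_congr rfl fun i _ => ?_
      induction comul (R := k) (r.left i) using TensorProduct.induction_on with
      | zero => simp
      | add x y hx hy => simp only [map_add, add_mul, hx, hy]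
      | tmul c d => simp [antipode_mul_antidistrib, mul_assoc]
  simpa [cointegralKernel] using key (comul y)

variable {ι : Type*} [Fintype ι] (b : Module.Basis ι k H)

/-- After the previous lemma, cyclicity brings multiplication by a₁ next to that by S(a₂) on the
traced leg, and a₁S(a₂) = ε(a)1. -/
theorem mul_partialTrace_cointegralKernel (a w : H) :
    a * partialTrace b (cointegralKernel k w) =
      counit (R := k) a • partialTrace b (cointegralKernel k w) := by
  have h1 : ∀ i, (LinearMap.mulLeft k ((ℛ k a).left i)).lTensor H ∘ₗ
      (LinearMap.mulLeft k (antipode k ((ℛ k a).right i))).lTensor H =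
      (LinearMap.mulLeft k ((ℛ k a).left i * antipode k ((ℛ k a).right i))).lTensor H := by
    intro i
    rw [← LinearMap.lTensor_comp, LinearMap.mulLeft_mul]
  have h2 : ∑ i ∈ (ℛ k a).index,
      (LinearMap.mulLeft k ((ℛ k a).left i * antipode k ((ℛ k a).right i))).lTensor H =
      counit (R := k) a • LinearMap.id := by
    refine TensorProduct.ext' fun x y => ?_
    simp only [LinearMap.sum_apply, LinearMap.lTensor_tmul, LinearMap.mulLeft_apply,
      ← TensorProduct.tmul_sum, ← Finset.sum_mul, sum_mul_antipode_eq_smul]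
    simp
  rw [← LinearMap.mulLeft_apply (R := k), map_partialTrace, mulLeft_cointegralKernel (ℛ k a),
    map_sum]
  simp only [← LinearMap.comp_assoc]
  simp only [← partialTrace_comp_comm]
  simp only [← LinearMap.comp_assoc, h1]
  rw [← map_sum, ← map_smul]
  congr 1
  ext1 y
  simpa using congr($h2 (cointegralKernel k w y))

/-- The trace of w ↦ S(h_w), with h_w the partial trace for w; it shows that not every h_w vanishes.
Summing over the basis vectors w = b_j turns the i-th term into b_i*(S²(y₂)S(y₁)) = b_i*(S(y₁S(y₂)))
for y = b_i, that is ε(b_i) b_i*(1), and these add up to ε(1). -/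
theorem sum_coord_antipode_partialTrace :
    ∑ j, b.coord j (antipode k (partialTrace b (cointegralKernel k (b j)))) = 1 := by
  have h1 : ∀ (i) (x : H ⊗[k] H), ∑ j, b.coord j (antipode k (TensorProduct.rid k H
      ((b.coord i).lTensor H ((LinearMap.mulRight k (b j) ∘ₗ antipode k ∘ₗ
        antipode k).lTensor H x)))) =
      b.coord i (antipode k (LinearMap.mul' k H ((antipode k).lTensor H x))) := by
    intro i x
    induction x using TensorProduct.induction_on with
    | zero => simp
    | add x y hx hy => simp only [map_add, Finset.sum_add_distrib, hx, hy]
    | tmul c d =>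
      simp only [LinearMap.lTensor_tmul, LinearMap.comp_apply, LinearMap.mulRight_apply,
        TensorProduct.rid_tmul, map_smul, LinearMap.mul'_apply, antipode_mul_antidistrib,
        smul_eq_mul]
      conv_rhs => rw [← b.sum_repr (antipode k c), Finset.mul_sum, map_sum]
      refine Finset.sum_congr rfl fun j _ => ?_
      rw [mul_smul_comm, map_smul, smul_eq_mul, mul_comm, Module.Basis.coord_apply]
  simp only [partialTrace_apply, map_sum, cointegralKernel, LinearMap.comp_apply] at h1 ⊢
  rw [Finset.sum_comm]
  simp only [h1, mul_antipode_lTensor_comul_apply, Algebra.algebraMap_eq_smul_one, map_smul,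
    antipode_one]
  have := congr(counit (R := k) $(b.sum_repr 1))
  rw [map_sum, Bialgebra.counit_one] at this
  simpa [mul_comm] using this

/-- A finite-dimensional Hopf algebra has a non-zero left cointegral. -/
theorem exists_ne_zero_forall_mul_eq_counit_smul [FiniteDimensional k H] :
    ∃ h : H, h ≠ 0 ∧ ∀ a : H, a * h = counit (R := k) a • h := by
  let b := Module.finBasis k H
  by_contra! hc
  have key : ∀ w, partialTrace b (cointegralKernel k w) = 0 := by
    intro w
    by_contra hw
    obtain ⟨a, ha⟩ := hc _ hw
    exact ha (mul_partialTrace_cointegralKernel b a w)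
  simpa [key] using sum_coord_antipode_partialTrace b

end Cointegral

/-! ### Calculus in multiplier algebras -/

section MultiplierLemmas

variable {A : Type*} [NonUnitalRing A] [Module ℂ A] [IsScalarTower ℂ A A] [SMulCommClass ℂ A A]
variable {B : Type*} [NonUnitalRing B] [Module ℂ B] [IsScalarTower ℂ B B] [SMulCommClass ℂ B B]

namespace Multiplier

theorem left_map_mul (m : Multiplier A) (x y : A) : m.left (x * y) = m.left x * y := m.2.1 x y

theorem right_map_mul (m : Multiplier A) (x y : A) : m.right (x * y) = x * m.right y := m.2.2.1 x y

theorem right_mul_eq (m : Multiplier A) (x y : A) : m.right x * y = x * m.left y := m.2.2.2 x y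

theorem ext {m n : Multiplier A} (hl : ∀ x, m.left x = n.left x)
    (hr : ∀ x, m.right x = n.right x) : m = n :=
  Subtype.ext (Prod.ext (LinearMap.ext hl) (MulOpposite.unop_injective (LinearMap.ext hr)))

theorem left_mul (m n : Multiplier A) (x : A) : (m * n).left x = m.left (n.left x) := rfl

theorem right_mul (m n : Multiplier A) (x : A) : (m * n).right x = n.right (m.right x) := rfl

theorem left_add (m n : Multiplier A) (x : A) : (m + n).left x = m.left x + n.left x := rfl

theorem left_zero (x : A) : (0 : Multiplier A).left x = 0 := rfl

theorem left_smul (c : ℂ) (m : Multiplier A) (x : A) : (c • m).left x = c • m.left x := rfl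

theorem left_of (x y : A) : (of x).left y = x * y := rfl

theorem left_tensor (m : Multiplier A) (n : Multiplier B) :
    (tensor m n).left = TensorProduct.map m.left n.left := rfl

theorem right_tensor (m : Multiplier A) (n : Multiplier B) :
    (tensor m n).right = TensorProduct.map m.right n.right := rfl

theorem mul_of (m : Multiplier A) (x : A) : m * of x = of (m.left x) :=
  ext (fun y => m.left_map_mul x y) (fun y => m.right_mul_eq y x)

theorem of_mul (m : Multiplier A) (x : A) : of x * m = of (m.right x) :=
  ext (fun y => (m.right_mul_eq x y).symm) (fun y => m.right_map_mul y x)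

theorem of_mul_of (x y : A) : (of x : Multiplier A) * of y = of (x * y) := mul_of _ _

theorem tensor_mul_tensor (m m' : Multiplier A) (n n' : Multiplier B) :
    tensor m n * tensor m' n' = tensor (m * m') (n * n') := by
  have hl : ∀ m m' : Multiplier A, (m * m').left = m.left ∘ₗ m'.left := fun _ _ => rfl
  have hl' : ∀ n n' : Multiplier B, (n * n').left = n.left ∘ₗ n'.left := fun _ _ => rfl
  have hr : ∀ m m' : Multiplier A, (m * m').right = m'.right ∘ₗ m.right := fun _ _ => rfl
  have hr' : ∀ n n' : Multiplier B, (n * n').right = n'.right ∘ₗ n.right := fun _ _ => rfl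
  refine ext (fun x => ?_) (fun x => ?_)
  · rw [left_mul, left_tensor, left_tensor, left_tensor, hl, hl', TensorProduct.map_comp]
    rfl
  · rw [right_mul, right_tensor, right_tensor, right_tensor, hr, hr', TensorProduct.map_comp]
    rfl

end Multiplier

open Multiplier

theorem left_oneTmul (b : A) (x : A ⊗[ℂ] A) :
    (oneTmul b).left x = (LinearMap.mulLeft ℂ b).lTensor A x := rfl

theorem right_oneTmul (b : A) (x : A ⊗[ℂ] A) :
    (oneTmul b).right x = (LinearMap.mulRight ℂ b).lTensor A x := rfl

theorem left_tmulOne (b : A) (x : A ⊗[ℂ] A) :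
    (tmulOne b).left x = (LinearMap.mulLeft ℂ b).rTensor A x := rfl

theorem oneTmul_mul_oneTmul (a b : A) :
    (oneTmul a : Multiplier (A ⊗[ℂ] A)) * oneTmul b = oneTmul (a * b) := by
  simp [oneTmul, tensor_mul_tensor, of_mul_of]

theorem tmulOne_mul_tmulOne (a b : A) :
    (tmulOne a : Multiplier (A ⊗[ℂ] A)) * tmulOne b = tmulOne (a * b) := by
  simp [tmulOne, tensor_mul_tensor, of_mul_of]

theorem mul_tmul_eq_map (x : A ⊗[ℂ] A) (a b : A) :
    x * (a ⊗ₜ b) = TensorProduct.map (LinearMap.mulRight ℂ a) (LinearMap.mulRight ℂ b) x := by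
  induction x using TensorProduct.induction_on with
  | zero => simp
  | add x y hx hy => simp [add_mul, hx, hy]
  | tmul c d => simp

/-- The linear map `a ↦ Δ(a) e`. -/
def comulAt (Δ : A →ₙₐ[ℂ] Multiplier (A ⊗[ℂ] A)) (e : A ⊗[ℂ] A) : A →ₗ[ℂ] A ⊗[ℂ] A where
  toFun a := (Δ a).left e
  map_add' a b := by rw [map_add, left_add]
  map_smul' c a := by rw [map_smul, left_smul]; rfl

theorem comulAt_apply (Δ : A →ₙₐ[ℂ] Multiplier (A ⊗[ℂ] A)) (e : A ⊗[ℂ] A) (a : A) :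
    comulAt Δ e a = (Δ a).left e := rfl

theorem comulAt_mul_right (Δ : A →ₙₐ[ℂ] Multiplier (A ⊗[ℂ] A)) (e f : A ⊗[ℂ] A) (a : A) :
    comulAt Δ (e * f) a = comulAt Δ e a * f := left_map_mul _ _ _

variable {Δ : A →ₙₐ[ℂ] Multiplier (A ⊗[ℂ] A)}

/-- This and the next lemma evaluate the two sides of the coassociativity axiom on b ⊗ c ⊗ d,
turning an identity of multipliers into one in the tensor cube of A. -/
theorem left_tensor_mul_comulTensorId (a b c d : A) (x : A ⊗[ℂ] A) :
    (Multiplier.tensor (tmulOne a) (1 : Multiplier A) * comulTensorId Δ x).left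
      ((b ⊗ₜ c) ⊗ₜ d) = TensorProduct.map ((LinearMap.mulLeft ℂ a).rTensor A ∘ₗ
        comulAt Δ (b ⊗ₜ c)) (LinearMap.mulRight ℂ d) x := by
  rw [left_mul]
  induction x using TensorProduct.induction_on with
  | zero => rw [map_zero, left_zero, map_zero, map_zero]
  | add x y hx hy => rw [map_add, left_add, map_add, map_add, hx, hy]
  | tmul s t => rfl

theorem left_reassoc_idTensorComul_mul (b c d e : A) (y : A ⊗[ℂ] A) :
    (reassoc A (idTensorComul Δ y * Multiplier.tensor (1 : Multiplier A) (oneTmul e))).left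
      ((b ⊗ₜ c) ⊗ₜ d) = (TensorProduct.assoc ℂ A A A).symm
        (TensorProduct.map (LinearMap.mulRight ℂ b) (comulAt Δ (c ⊗ₜ (e * d))) y) := by
  change (TensorProduct.assoc ℂ A A A).symm
    ((idTensorComul Δ y).left (b ⊗ₜ (c ⊗ₜ (e * d)))) = _
  congr 1
  induction y using TensorProduct.induction_on with
  | zero => rw [map_zero, left_zero, map_zero]
  | add x y hx hy => rw [map_add, left_add, map_add, hx, hy]
  | tmul s t => rfl

end MultiplierLemmas

/-! ### A component as a unital algebra -/

section UnitalSub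

variable {A : Type*} [NonUnitalRing A] [Module ℂ A] [IsScalarTower ℂ A A] [SMulCommClass ℂ A A]
variable {B : NonUnitalSubalgebra ℂ A} {u : B} {hu : IsIdentity B u}

instance : Module ℂ (UnitalSub B u hu) := inferInstanceAs (Module ℂ B)

instance : Algebra ℂ (UnitalSub B u hu) :=
  Algebra.ofModule (fun r x y => Subtype.ext (smul_mul_assoc r x.val y.val))
    (fun r x y => Subtype.ext (mul_smul_comm r x.val y.val))

namespace UnitalSub

/-- The inclusion of a subalgebra with identity. -/
def incl : UnitalSub B u hu →ₗ[ℂ] A where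
  toFun := val
  map_add' _ _ := rfl
  map_smul' _ _ := rfl

theorem incl_mul (a b : UnitalSub B u hu) : incl (a * b) = incl a * incl b := rfl

theorem incl_one : incl (1 : UnitalSub B u hu) = u := rfl

theorem incl_mem (a : UnitalSub B u hu) : incl a ∈ B := a.2

theorem incl_mul_identity (a : UnitalSub B u hu) : incl a * (u : A) = incl a :=
  congr(Subtype.val $((hu a).2))

theorem identity_mul_incl (a : UnitalSub B u hu) : (u : A) * incl a = incl a :=
  congr(Subtype.val $((hu a).1))

theorem incl_injective : Function.Injective (incl (hu := hu)) := Subtype.val_injective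

theorem exists_incl {a : A} (ha : a ∈ B) : ∃ b : UnitalSub B u hu, incl b = a := ⟨⟨a, ha⟩, rfl⟩

theorem map_incl_mul (x y : UnitalSub B u hu ⊗[ℂ] UnitalSub B u hu) :
    TensorProduct.map incl incl (x * y) =
      TensorProduct.map incl incl x * TensorProduct.map incl incl y := by
  induction x using TensorProduct.induction_on with
  | zero => simp
  | add x y hx hy => simp [add_mul, hx, hy]
  | tmul a b =>
    induction y using TensorProduct.induction_on with
    | zero => simp
    | add x y hx hy => simp [mul_add, hx, hy]
    | tmul c d => simp [incl_mul]

theorem map_incl_mul_identity (x : UnitalSub B u hu ⊗[ℂ] UnitalSub B u hu) :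
    TensorProduct.map incl incl x * ((u : A) ⊗ₜ[ℂ] (u : A)) = TensorProduct.map incl incl x := by
  have := map_incl_mul x 1
  rwa [mul_one, Algebra.TensorProduct.one_def, TensorProduct.map_tmul, incl_one, eq_comm] at this

theorem map_incl_injective : Function.Injective
    (TensorProduct.map (incl (hu := hu)) (incl (hu := hu))) :=
  TensorProduct.map_injective_of_flat_flat _ _ incl_injective incl_injective

variable (hB : ∀ a : A, a * u ∈ B)

/-- The retraction `a ↦ a u` onto a subalgebra with identity `u`. -/
def retract : A →ₗ[ℂ] UnitalSub B u hu where
  toFun a := ⟨a * u, hB a⟩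
  map_add' a b := Subtype.ext (add_mul a b _)
  map_smul' c a := Subtype.ext (smul_mul_assoc c a _)

theorem incl_retract (a : A) : incl (retract (hu := hu) hB a) = a * u := rfl

theorem retract_incl (a : UnitalSub B u hu) : retract hB (incl a) = a :=
  incl_injective (incl_mul_identity a)

variable (Δ : A →ₙₐ[ℂ] Multiplier (A ⊗[ℂ] A))

/-- The component `b ↦ Δ(b)(u ⊗ u)` of a comultiplication. -/
def comul : UnitalSub B u hu →ₗ[ℂ] UnitalSub B u hu ⊗[ℂ] UnitalSub B u hu :=
  TensorProduct.map (retract hB) (retract hB) ∘ₗ comulAt Δ ((u : A) ⊗ₜ (u : A)) ∘ₗ incl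

include hu in
theorem identity_mul_identity : (u : A) * (u : A) = u := congr(Subtype.val $((hu u).1))

/-- Retracting both legs is right multiplication by u ⊗ u, which fixes Δ(b)(u ⊗ u). -/
theorem map_incl_comul (b : UnitalSub B u hu) : TensorProduct.map incl incl (comul hB Δ b) =
    comulAt Δ ((u : A) ⊗ₜ (u : A)) (incl b) := by
  have h1 : incl (hu := hu) ∘ₗ retract hB = LinearMap.mulRight ℂ (u : A) := rfl
  rw [comul, LinearMap.comp_apply, ← LinearMap.comp_apply, ← TensorProduct.map_comp, h1,
    ← mul_tmul_eq_map, LinearMap.comp_apply, ← comulAt_mul_right,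
    Algebra.TensorProduct.tmul_mul_tmul, identity_mul_identity (hu := hu)]

end UnitalSub

end UnitalSub

open Multiplier

/-! ### Components of a cograded comultiplication -/

section Cograded

variable {G : Type*} [Group G]
variable {A : Type*} [NonUnitalRing A] [Module ℂ A] [IsScalarTower ℂ A A] [SMulCommClass ℂ A A]
variable {Δ : A →ₙₐ[ℂ] Multiplier (A ⊗[ℂ] A)} {𝒜 : G → NonUnitalSubalgebra ℂ A}

theorem IsIdentity.mul_eq {B : NonUnitalSubalgebra ℂ A} {u : B} (hu : IsIdentity B u) {a : A}
    (ha : a ∈ B) : (u : A) * a = a := congr(Subtype.val $((hu ⟨a, ha⟩).1))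

theorem IsIdentity.eq_mul {B : NonUnitalSubalgebra ℂ A} {u : B} (hu : IsIdentity B u) {a : A}
    (ha : a ∈ B) : a * (u : A) = a := congr(Subtype.val $((hu ⟨a, ha⟩).2))

namespace IsCograded

variable (h𝒜 : IsCograded Δ 𝒜) {u : ∀ p, 𝒜 p} (hu : ∀ p, IsIdentity (𝒜 p) (u p))

include h𝒜

/-- To prove a statement for all elements, it suffices to prove it on the components. -/
theorem induction_components {P : A → Prop} (hP : ∀ p, ∀ a ∈ 𝒜 p, P a) (h0 : P 0)
    (hadd : ∀ a b, P a → P b → P (a + b)) (a : A) : P a :=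
  Submodule.iSup_induction (fun p => (𝒜 p).toSubmodule) (motive := P)
    (h𝒜.iSup_eq_top ▸ Submodule.mem_top) hP h0 hadd

include hu

theorem mul_identity_of_ne {p q : G} (hpq : q ≠ p) {a : A} (ha : a ∈ 𝒜 q) :
    a * (u p : A) = 0 := h𝒜.mul_eq_zero q p hpq a ha _ (u p).2

theorem identity_comm (p : G) (a : A) : (u p : A) * a = a * u p := by
  induction a using h𝒜.induction_components with
  | hP q a ha =>
    by_cases hqp : q = p
    · subst hqp
      rw [(hu q).mul_eq ha, (hu q).eq_mul ha]
    · rw [h𝒜.mul_identity_of_ne hu hqp ha,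
        h𝒜.mul_eq_zero p q (Ne.symm hqp) _ (u p).2 _ ha]
  | h0 => simp
  | hadd a b ha hb => rw [mul_add, add_mul, ha, hb]

theorem mul_identity_mem (p : G) (a : A) : a * (u p : A) ∈ 𝒜 p := by
  induction a using h𝒜.induction_components with
  | hP q a ha =>
    by_cases hqp : q = p
    · subst hqp
      rwa [(hu q).eq_mul ha]
    · rw [h𝒜.mul_identity_of_ne hu hqp ha]
      exact zero_mem _
  | h0 => simp
  | hadd a b ha hb => rw [add_mul]; exact add_mem ha hb

theorem identity_mul_identity (p : G) : (u p : A) * (u p : A) = u p := (hu p).mul_eq (u p).2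

theorem identity_ne_zero (p : G) : (u p : A) ≠ 0 := by
  intro h0
  refine h𝒜.ne_bot p (eq_bot_iff.2 fun a ha => ?_)
  rw [← (hu p).mul_eq ha, h0, zero_mul]
  exact zero_mem _

theorem tmul_identity_comm (p q : G) (x : A ⊗[ℂ] A) :
    ((u p : A) ⊗ₜ[ℂ] (u q : A)) * x = x * ((u p : A) ⊗ₜ[ℂ] (u q : A)) := by
  induction x using TensorProduct.induction_on with
  | zero => simp
  | add x y hx hy => rw [mul_add, add_mul, hx, hy]
  | tmul a b => simp [h𝒜.identity_comm hu]

theorem tmul_identity_mul_self (p q : G) : ((u p : A) ⊗ₜ[ℂ] (u q : A)) * ((u p : A) ⊗ₜ[ℂ] (u q : A)) =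
    (u p : A) ⊗ₜ[ℂ] (u q : A) := by
  simp [h𝒜.identity_mul_identity hu]

/-- Local units: A may lack an identity when G is infinite, but finite sums of the 1_p act as one on
any given element. They make A ⊗ A → M(A ⊗ A) injective. -/
theorem eventually_mul_sum_identity (a : A) :
    ∀ᶠ F : Finset G in Filter.atTop, a * ∑ p ∈ F, (u p : A) = a := by
  induction a using h𝒜.induction_components with
  | hP q a ha =>
    filter_upwards [Filter.eventually_ge_atTop {q}] with F hF
    rw [Finset.mul_sum, Finset.sum_eq_single q, (hu q).eq_mul ha]
    · exact fun p _ hp => h𝒜.mul_identity_of_ne hu (Ne.symm hp) ha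
    · exact fun hq => absurd (Finset.singleton_subset_iff.1 hF) hq
  | h0 => simp
  | hadd a b ha hb =>
    filter_upwards [ha, hb] with F ha hb
    rw [add_mul, ha, hb]

theorem eventually_mul_sum_tmul_sum_identity (x : A ⊗[ℂ] A) : ∀ᶠ F : Finset G in Filter.atTop,
    x * ((∑ p ∈ F, (u p : A)) ⊗ₜ[ℂ] (∑ p ∈ F, (u p : A))) = x := by
  induction x using TensorProduct.induction_on with
  | zero => simp
  | add x y hx hy =>
    filter_upwards [hx, hy] with F hx hy
    rw [add_mul, hx, hy]
  | tmul a b =>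
    filter_upwards [h𝒜.eventually_mul_sum_identity hu a, h𝒜.eventually_mul_sum_identity hu b]
      with F ha hb
    rw [Algebra.TensorProduct.tmul_mul_tmul, ha, hb]

theorem of_injective : Function.Injective (of (A := A ⊗[ℂ] A)) := by
  refine (injective_iff_map_eq_zero _).2 fun x hx => ?_
  obtain ⟨F, hF⟩ := (h𝒜.eventually_mul_sum_tmul_sum_identity hu x).exists
  rw [← hF, ← left_of, hx, left_zero]

theorem range_mapIncl_mul_identity {p q : G} {x : A ⊗[ℂ] A} (hx : x ∈ LinearMap.range
    (TensorProduct.mapIncl (𝒜 p).toSubmodule (𝒜 q).toSubmodule)) :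
    x * ((u p : A) ⊗ₜ[ℂ] (u q : A)) = x := by
  obtain ⟨y, rfl⟩ := hx
  induction y using TensorProduct.induction_on with
  | zero => simp
  | add x y hx hy => rw [map_add, add_mul, hx, hy]
  | tmul a b =>
    simp [TensorProduct.mapIncl, (hu p).eq_mul a.2, (hu q).eq_mul b.2]

theorem range_mapIncl_mul_identity_of_ne {p p' q : G} (hp : p ≠ p') {x : A ⊗[ℂ] A}
    (hx : x ∈ LinearMap.range
      (TensorProduct.mapIncl (𝒜 p).toSubmodule (𝒜 q).toSubmodule)) :
    x * ((u p' : A) ⊗ₜ[ℂ] (u q : A)) = 0 := by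
  obtain ⟨y, rfl⟩ := hx
  induction y using TensorProduct.induction_on with
  | zero => simp
  | add x y hx hy => rw [map_add, add_mul, hx, hy, add_zero]
  | tmul a b =>
    simp [TensorProduct.mapIncl, h𝒜.mul_identity_of_ne hu hp a.2]

omit hu in
theorem exists_of_eq_comul_mul {s p q : G} (hs : s = p * q) {a b : A} (ha : a ∈ 𝒜 s)
    (hb : b ∈ 𝒜 q) : ∃ x ∈ LinearMap.range
      (TensorProduct.mapIncl (𝒜 p).toSubmodule (𝒜 q).toSubmodule), of x = Δ a * oneTmul b := by
  subst hs
  have := Submodule.mul_mem_mul (Submodule.mem_map_of_mem ha) (Submodule.mem_map_of_mem hb)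
    (M := (𝒜 (p * q)).toSubmodule.map (Δ : A →ₗ[ℂ] Multiplier (A ⊗[ℂ] A)))
    (N := (𝒜 q).toSubmodule.map oneTmul)
  rw [h𝒜.comul_mul] at this
  exact this

omit hu in
theorem exists_of_eq_mul_comul {s p q : G} (hs : s = p * q) {a b : A} (ha : a ∈ 𝒜 p)
    (hb : b ∈ 𝒜 s) : ∃ x ∈ LinearMap.range
      (TensorProduct.mapIncl (𝒜 p).toSubmodule (𝒜 q).toSubmodule), of x = tmulOne a * Δ b := by
  subst hs
  have := Submodule.mul_mem_mul (Submodule.mem_map_of_mem ha) (Submodule.mem_map_of_mem hb)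
    (M := (𝒜 p).toSubmodule.map tmulOne)
    (N := (𝒜 (p * q)).toSubmodule.map (Δ : A →ₗ[ℂ] Multiplier (A ⊗[ℂ] A)))
  rw [h𝒜.mul_comul] at this
  exact this

theorem mul_tmul_identity_of_eq_comul_mul {a : A} {x : A ⊗[ℂ] A} (p q : G)
    (hx : of x = Δ a * oneTmul (u q : A)) : x * ((u p : A) ⊗ₜ[ℂ] (u q : A)) = comulAt Δ (u p ⊗ₜ u q) a := by
  rw [← left_of, hx, left_mul, left_oneTmul, LinearMap.lTensor_tmul, LinearMap.mulLeft_apply,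
    h𝒜.identity_mul_identity hu, comulAt_apply]

theorem comulAt_mul_tmul_identity (p q : G) (a : A) :
    comulAt Δ (u p ⊗ₜ u q) a * ((u p : A) ⊗ₜ[ℂ] (u q : A)) = comulAt Δ (u p ⊗ₜ u q) a := by
  rw [← comulAt_mul_right, h𝒜.tmul_identity_mul_self hu]

theorem rTensor_mulLeft_comulAt (p q : G) (a : A) :
    (LinearMap.mulLeft ℂ (u p : A)).rTensor A (comulAt Δ (u p ⊗ₜ u q) a) =
      comulAt Δ (u p ⊗ₜ u q) a := by
  have key : ∀ x : A ⊗[ℂ] A, (LinearMap.mulLeft ℂ (u p : A)).rTensor A (x * ((u p : A) ⊗ₜ[ℂ] (u q : A))) =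
      x * ((u p : A) ⊗ₜ[ℂ] (u q : A)) := by
    intro x
    induction x using TensorProduct.induction_on with
    | zero => simp
    | add x y hx hy => rw [add_mul, map_add, hx, hy]
    | tmul a b =>
      simp [h𝒜.identity_comm hu p, mul_assoc, h𝒜.identity_mul_identity hu]
  rw [← h𝒜.comulAt_mul_tmul_identity hu, key]

theorem mul_tmul_identity_of_eq_mul_comul {a : A} {y : A ⊗[ℂ] A} (p q : G)
    (hy : of y = tmulOne (u p : A) * Δ a) : y * ((u p : A) ⊗ₜ[ℂ] (u q : A)) = comulAt Δ (u p ⊗ₜ u q) a := by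
  rw [← left_of, hy, left_mul, left_tmulOne, ← comulAt_apply, h𝒜.rTensor_mulLeft_comulAt hu]

/-- For a in A_t, Δ(a)(1 ⊗ 1_q) lies in A_{tq⁻¹} ⊗ A_q, so multiplying by 1_p ⊗ 1_q kills it unless
t = pq. -/
theorem comulAt_mul_identity {s p q : G} (hs : s = p * q) (a : A) :
    comulAt Δ (u p ⊗ₜ u q) (a * u s) = comulAt Δ (u p ⊗ₜ u q) a := by
  induction a using h𝒜.induction_components with
  | hP t a ha =>
    by_cases hts : t = s
    · subst hts
      rw [(hu t).eq_mul ha]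
    · rw [h𝒜.mul_identity_of_ne hu hts ha, map_zero]
      obtain ⟨x, hx, hxa⟩ := h𝒜.exists_of_eq_comul_mul (inv_mul_cancel_right t q).symm ha (u q).2
      rw [← h𝒜.mul_tmul_identity_of_eq_comul_mul hu p q hxa,
        h𝒜.range_mapIncl_mul_identity_of_ne hu _ hx]
      rintro rfl
      exact hts (by rw [hs, inv_mul_cancel_right])
  | h0 => simp
  | hadd a b ha hb => rw [add_mul, map_add, map_add, ha, hb]

/-- Coassociativity of the components of a cograded comultiplication. -/
theorem comulAt_coassoc (hΔ : IsComultiplication Δ) {p q r s t : G} (hs : s = p * q)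
    (ht : t = q * r) (a : A) :
    TensorProduct.assoc ℂ A A A
        ((comulAt Δ (u p ⊗ₜ u q)).rTensor A (comulAt Δ (u s ⊗ₜ u r) a)) =
      (comulAt Δ (u q ⊗ₜ u r)).lTensor A (comulAt Δ (u p ⊗ₜ u t) a) := by
  obtain ⟨x, hx⟩ := hΔ.comul_mul_mem a (u r)
  obtain ⟨y, hy⟩ := hΔ.mul_comul_mem (u p) a
  -- Evaluated at 1_p ⊗ 1_q ⊗ 1_r. The uncut x and y may then be replaced by their (s, r) and (p, t)
  -- parts, because Δ_{p,q} and Δ_{q,r} ignore everything outside A_s and A_t.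
  have h1 := congr(($(hΔ.coassoc (u p) a (u r) x y hx hy)).left ((u p ⊗ₜ u q) ⊗ₜ u r))
  rw [left_tensor_mul_comulTensorId, left_reassoc_idTensorComul_mul,
    h𝒜.identity_mul_identity hu] at h1
  have h2 : (LinearMap.mulLeft ℂ (u p : A)).rTensor A ∘ₗ comulAt Δ (u p ⊗ₜ u q) =
      comulAt Δ (u p ⊗ₜ u q) := LinearMap.ext (h𝒜.rTensor_mulLeft_comulAt hu p q)
  have h3 : comulAt Δ (u p ⊗ₜ u q) ∘ₗ LinearMap.mulRight ℂ (u s : A) =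
      comulAt Δ (u p ⊗ₜ u q) := LinearMap.ext (h𝒜.comulAt_mul_identity hu hs)
  have h4 : comulAt Δ (u q ⊗ₜ u r) ∘ₗ LinearMap.mulRight ℂ (u t : A) =
      comulAt Δ (u q ⊗ₜ u r) := LinearMap.ext (h𝒜.comulAt_mul_identity hu ht)
  rw [← h𝒜.mul_tmul_identity_of_eq_comul_mul hu s r hx,
    ← h𝒜.mul_tmul_identity_of_eq_mul_comul hu p t hy, mul_tmul_eq_map, mul_tmul_eq_map,
    ← LinearMap.comp_apply (LinearMap.rTensor A _), LinearMap.rTensor_comp_map,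
    ← LinearMap.comp_apply (LinearMap.lTensor A _), LinearMap.lTensor_comp_map, h3, h4,
    ← LinearEquiv.eq_symm_apply, ← h1, h2]

theorem comulAt_mul (p q : G) (a b : A) : comulAt Δ (u p ⊗ₜ u q) (a * b) =
    comulAt Δ (u p ⊗ₜ u q) a * comulAt Δ (u p ⊗ₜ u q) b := by
  rw [comulAt_apply, map_mul, left_mul, ← comulAt_apply, ← comulAt_apply,
    ← comulAt_mul_right, h𝒜.tmul_identity_comm hu, h𝒜.comulAt_mul_tmul_identity hu]

/-- For a in A_q, Δ(a)(1 ⊗ 1_q) already lies in A_e ⊗ A_q, so it equals Δ_{e,q}(a). If this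
vanishes, injectivity of the Galois map gives a ⊗ 1_q = 0, and 1_q is non-zero. -/
theorem comulAt_one_left_injOn (hΔ : IsMultiplierHopfAlgebra Δ) (q : G) {a : A} (ha : a ∈ 𝒜 q)
    (h0 : comulAt Δ (u 1 ⊗ₜ u q) a = 0) : a = 0 := by
  obtain ⟨T, hT⟩ := hΔ.bijective_left
  obtain ⟨x, hx, hxa⟩ := h𝒜.exists_of_eq_comul_mul (one_mul q).symm ha (u q).2
  have hTx : T (a ⊗ₜ u q) = 0 := by
    rw [h𝒜.of_injective hu ((hT _ _).trans hxa.symm), ← h𝒜.range_mapIncl_mul_identity hu hx,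
      h𝒜.mul_tmul_identity_of_eq_comul_mul hu 1 q hxa, h0]
  rw [LinearEquiv.map_eq_zero_iff] at hTx
  obtain ⟨f, hf⟩ := exists_dual_eq_one ℂ (h𝒜.identity_ne_zero hu q)
  simpa [hf] using congr(TensorProduct.rid ℂ A (f.lTensor A $hTx))

theorem comulAt_one_right_injOn (hΔ : IsMultiplierHopfAlgebra Δ) (q : G) {a : A} (ha : a ∈ 𝒜 q)
    (h0 : comulAt Δ (u q ⊗ₜ u 1) a = 0) : a = 0 := by
  obtain ⟨T, hT⟩ := hΔ.bijective_right
  obtain ⟨x, hx, hxa⟩ := h𝒜.exists_of_eq_mul_comul (mul_one q).symm (u q).2 ha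
  have hTx : T (u q ⊗ₜ a) = 0 := by
    rw [h𝒜.of_injective hu ((hT _ _).trans hxa.symm), ← h𝒜.range_mapIncl_mul_identity hu hx,
      h𝒜.mul_tmul_identity_of_eq_mul_comul hu q 1 hxa, h0]
  rw [LinearEquiv.map_eq_zero_iff] at hTx
  obtain ⟨f, hf⟩ := exists_dual_eq_one ℂ (h𝒜.identity_ne_zero hu q)
  simpa [hf] using congr(TensorProduct.lid ℂ A (f.rTensor A $hTx))

/-- The comultiplication on the component of the identity of `G`. -/
abbrev comulOne : UnitalSub (𝒜 1) (u 1) (hu 1) →ₗ[ℂ]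
    UnitalSub (𝒜 1) (u 1) (hu 1) ⊗[ℂ] UnitalSub (𝒜 1) (u 1) (hu 1) :=
  UnitalSub.comul (h𝒜.mul_identity_mem hu 1) Δ

open UnitalSub

theorem map_incl_comulOne (b : UnitalSub (𝒜 1) (u 1) (hu 1)) :
    TensorProduct.map incl incl (h𝒜.comulOne hu b) = comulAt Δ (u 1 ⊗ₜ u 1) (incl b) :=
  map_incl_comul _ _ _

theorem comulOne_coassoc (hΔ : IsComultiplication Δ) (a : UnitalSub (𝒜 1) (u 1) (hu 1)) :
    TensorProduct.assoc ℂ _ _ _ ((h𝒜.comulOne hu).rTensor _ (h𝒜.comulOne hu a)) =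
      (h𝒜.comulOne hu).lTensor _ (h𝒜.comulOne hu a) := by
  have hinj : Function.Injective (TensorProduct.map (incl (hu := hu 1))
      (TensorProduct.map (incl (hu := hu 1)) (incl (hu := hu 1)))) :=
    TensorProduct.map_injective_of_flat_flat _ _ incl_injective map_incl_injective
  apply hinj
  have h1 := h𝒜.comulAt_coassoc hu hΔ (one_mul (1 : G)).symm (one_mul (1 : G)).symm (incl a)
  rw [← h𝒜.map_incl_comulOne hu] at h1
  have h2 : ∀ x : UnitalSub (𝒜 1) (u 1) (hu 1) ⊗[ℂ] UnitalSub (𝒜 1) (u 1) (hu 1),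
      TensorProduct.map incl (TensorProduct.map incl incl)
        (TensorProduct.assoc ℂ _ _ _ ((h𝒜.comulOne hu).rTensor _ x)) =
      TensorProduct.assoc ℂ _ _ _ ((comulAt Δ (u 1 ⊗ₜ u 1)).rTensor A
        (TensorProduct.map incl incl x)) := by
    intro x
    induction x using TensorProduct.induction_on with
    | zero => simp
    | add x y hx hy => simp only [map_add, hx, hy]
    | tmul c d =>
      rw [LinearMap.rTensor_tmul, TensorProduct.map_tmul, LinearMap.rTensor_tmul,
        ← h𝒜.map_incl_comulOne hu]
      induction h𝒜.comulOne hu c using TensorProduct.induction_on with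
      | zero => simp
      | add x y hx hy => simp only [map_add, TensorProduct.add_tmul, hx, hy]
      | tmul _ _ => rfl
  have h3 : ∀ x : UnitalSub (𝒜 1) (u 1) (hu 1) ⊗[ℂ] UnitalSub (𝒜 1) (u 1) (hu 1),
      TensorProduct.map incl (TensorProduct.map incl incl)
        ((h𝒜.comulOne hu).lTensor _ x) =
      (comulAt Δ (u 1 ⊗ₜ u 1)).lTensor A (TensorProduct.map incl incl x) := by
    intro x
    induction x using TensorProduct.induction_on with
    | zero => simp
    | add x y hx hy => simp only [map_add, hx, hy]
    | tmul c d =>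
      rw [LinearMap.lTensor_tmul, TensorProduct.map_tmul, TensorProduct.map_tmul,
        LinearMap.lTensor_tmul, h𝒜.map_incl_comulOne hu]
  rw [h2, h3, h1]

theorem mapIncl_range_of_map_incl (x : UnitalSub (𝒜 1) (u 1) (hu 1) ⊗[ℂ]
    UnitalSub (𝒜 1) (u 1) (hu 1)) : TensorProduct.map incl incl x ∈ LinearMap.range
      (TensorProduct.mapIncl (𝒜 1).toSubmodule (𝒜 1).toSubmodule) := by
  induction x using TensorProduct.induction_on with
  | zero => simp
  | add x y hx hy => rw [map_add]; exact add_mem hx hy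
  | tmul a b => exact ⟨(⟨incl a, incl_mem a⟩ : (𝒜 1).toSubmodule) ⊗ₜ
      (⟨incl b, incl_mem b⟩ : (𝒜 1).toSubmodule), rfl⟩

/-- The grading condition at p = q = e, which is stated in M(A ⊗ A). Letting multipliers act on 1_e
⊗ 1_e brings it back to A_e ⊗ A_e. -/
theorem galoisLeft_comulOne_surjective :
    Function.Surjective (galoisLeft (h𝒜.comulOne hu)) := by
  intro x
  have hx := Submodule.mem_map_of_mem (f := of) (h𝒜.mapIncl_range_of_map_incl hu x)
  have hc := h𝒜.comul_mul 1 1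
  rw [mul_one] at hc
  rw [← hc] at hx
  have key : ∀ m ∈ (𝒜 1).toSubmodule.map (Δ : A →ₗ[ℂ] Multiplier (A ⊗[ℂ] A)) *
      (𝒜 1).toSubmodule.map oneTmul, ∃ z, TensorProduct.map incl incl
        (galoisLeft (h𝒜.comulOne hu) z) = m.left ((u 1 : A) ⊗ₜ[ℂ] (u 1 : A)) := by
    intro m hm
    induction hm using Submodule.mul_induction_on' with
    | mem_mul_mem m hm n hn =>
      obtain ⟨a, ha, rfl⟩ := hm
      obtain ⟨b, hb, rfl⟩ := hn
      obtain ⟨a, rfl⟩ := exists_incl (hu := hu 1) ha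
      obtain ⟨b, rfl⟩ := exists_incl (hu := hu 1) hb
      refine ⟨a ⊗ₜ b, ?_⟩
      rw [galoisLeft_tmul, map_incl_mul, h𝒜.map_incl_comulOne hu, left_mul, left_oneTmul,
        LinearMap.lTensor_tmul, LinearMap.mulLeft_apply, TensorProduct.map_tmul, incl_one,
        ← comulAt_mul_right, Algebra.TensorProduct.tmul_mul_tmul, h𝒜.identity_mul_identity hu,
        h𝒜.identity_comm hu]
      rfl
    | add m _ n _ hm hn =>
      obtain ⟨z, hz⟩ := hm
      obtain ⟨w, hw⟩ := hn
      exact ⟨z + w, by rw [map_add, map_add, hz, hw, left_add]⟩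
  obtain ⟨z, hz⟩ := key _ hx
  refine ⟨z, map_incl_injective ?_⟩
  rw [hz, left_of, map_incl_mul_identity]

theorem galoisRight_comulOne_surjective :
    Function.Surjective (galoisRight (h𝒜.comulOne hu)) := by
  intro x
  have hx := Submodule.mem_map_of_mem (f := of) (h𝒜.mapIncl_range_of_map_incl hu x)
  have hc := h𝒜.mul_comul 1 1
  rw [mul_one] at hc
  rw [← hc] at hx
  have key : ∀ m ∈ (𝒜 1).toSubmodule.map tmulOne *
      (𝒜 1).toSubmodule.map (Δ : A →ₗ[ℂ] Multiplier (A ⊗[ℂ] A)), ∃ z,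
        TensorProduct.map incl incl (galoisRight (h𝒜.comulOne hu) z) =
          m.left ((u 1 : A) ⊗ₜ[ℂ] (u 1 : A)) := by
    intro m hm
    induction hm using Submodule.mul_induction_on' with
    | mem_mul_mem m hm n hn =>
      obtain ⟨a, ha, rfl⟩ := hm
      obtain ⟨b, hb, rfl⟩ := hn
      obtain ⟨a, rfl⟩ := exists_incl (hu := hu 1) ha
      obtain ⟨b, rfl⟩ := exists_incl (hu := hu 1) hb
      refine ⟨a ⊗ₜ b, ?_⟩
      have h1 : (Δ (incl b)).left ((u 1 : A) ⊗ₜ[ℂ] (u 1 : A)) =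
          TensorProduct.map incl incl (h𝒜.comulOne hu b) := (h𝒜.map_incl_comulOne hu b).symm
      rw [galoisRight_tmul, left_mul, left_tmulOne]
      change _ = (LinearMap.mulLeft ℂ (incl a)).rTensor A ((Δ (incl b)).left _)
      rw [h1]
      induction h𝒜.comulOne hu b using TensorProduct.induction_on with
      | zero => simp
      | add x y hx hy => rw [mul_add, map_add, map_add, map_add, hx, hy]
      | tmul c d => simp [incl_mul]
    | add m _ n _ hm hn =>
      obtain ⟨z, hz⟩ := hm
      obtain ⟨w, hw⟩ := hn
      exact ⟨z + w, by rw [map_add, map_add, hz, hw, left_add]⟩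
  obtain ⟨z, hz⟩ := key _ hx
  refine ⟨z, map_incl_injective ?_⟩
  rw [hz, left_of, map_incl_mul_identity]

theorem isGaloisComul_comulOne (hΔ : IsComultiplication Δ)
    [FiniteDimensional ℂ (UnitalSub (𝒜 1) (u 1) (hu 1))] :
    IsGaloisComul (h𝒜.comulOne hu) where
  map_mul a b := map_incl_injective <| by
    rw [map_incl_mul, h𝒜.map_incl_comulOne hu, h𝒜.map_incl_comulOne hu,
      h𝒜.map_incl_comulOne hu, incl_mul, h𝒜.comulAt_mul hu]
  coassoc := LinearMap.ext (h𝒜.comulOne_coassoc hu hΔ)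
  bijective_left :=
    -- A surjective endomorphism of a finite-dimensional space is injective.
    ⟨LinearMap.injective_iff_surjective.2 (h𝒜.galoisLeft_comulOne_surjective hu),
      h𝒜.galoisLeft_comulOne_surjective hu⟩
  surjective_right := h𝒜.galoisRight_comulOne_surjective hu

end IsCograded

end Cograded

/-! ### The counit of A from that of the identity component -/

section Counit

variable {A : Type*} [NonUnitalRing A] [Module ℂ A] [IsScalarTower ℂ A A] [SMulCommClass ℂ A A]

theorem lid_rTensor_map_mulRight (f : A →ₗ[ℂ] ℂ) (a b : A) (x : A ⊗[ℂ] A) :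
    TensorProduct.lid ℂ A (f.rTensor A
      (TensorProduct.map (LinearMap.mulRight ℂ a) (LinearMap.mulRight ℂ b) x)) =
      TensorProduct.lid ℂ A ((f ∘ₗ LinearMap.mulRight ℂ a).rTensor A x) * b := by
  induction x using TensorProduct.induction_on with
  | zero => simp
  | add x y hx hy => simp only [map_add, add_mul, hx, hy]
  | tmul c d => simp [smul_mul_assoc]

theorem rid_lTensor_map_mulRight (f : A →ₗ[ℂ] ℂ) (a b : A) (x : A ⊗[ℂ] A) :
    TensorProduct.rid ℂ A (f.lTensor A
      (TensorProduct.map (LinearMap.mulRight ℂ a) (LinearMap.mulRight ℂ b) x)) =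
      TensorProduct.rid ℂ A ((f ∘ₗ LinearMap.mulRight ℂ b).lTensor A x) * a := by
  induction x using TensorProduct.induction_on with
  | zero => simp
  | add x y hx hy => simp only [map_add, add_mul, hx, hy]
  | tmul c d => simp [smul_mul_assoc]

theorem lid_rTensor_lTensor_mulRight (f : A →ₗ[ℂ] ℂ) (b : A) (x : A ⊗[ℂ] A) :
    TensorProduct.lid ℂ A (f.rTensor A ((LinearMap.mulRight ℂ b).lTensor A x)) =
      TensorProduct.lid ℂ A (f.rTensor A x) * b := by
  induction x using TensorProduct.induction_on with
  | zero => simp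
  | add x y hx hy => simp only [map_add, add_mul, hx, hy]
  | tmul c d => simp [smul_mul_assoc]

theorem rid_lTensor_rTensor_mulLeft (f : A →ₗ[ℂ] ℂ) (b : A) (x : A ⊗[ℂ] A) :
    TensorProduct.rid ℂ A (f.lTensor A ((LinearMap.mulLeft ℂ b).rTensor A x)) =
      b * TensorProduct.rid ℂ A (f.lTensor A x) := by
  induction x using TensorProduct.induction_on with
  | zero => simp
  | add x y hx hy => simp only [map_add, mul_add, hx, hy]
  | tmul c d => simp [mul_smul_comm]

variable {G : Type*} [Group G]
variable {Δ : A →ₙₐ[ℂ] Multiplier (A ⊗[ℂ] A)} {𝒜 : G → NonUnitalSubalgebra ℂ A}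

namespace IsCograded

open UnitalSub

variable (h𝒜 : IsCograded Δ 𝒜) {u : ∀ p, 𝒜 p} (hu : ∀ p, IsIdentity (𝒜 p) (u p))

/-- The extension of a character of the component of the identity of `G` by zero on the other
components. -/
def extendChar (ε : UnitalSub (𝒜 1) (u 1) (hu 1) →ₗ[ℂ] ℂ)
    (hε : ∀ a b, ε (a * b) = ε a * ε b) : A →ₙₐ[ℂ] ℂ where
  toFun a := ε (retract (h𝒜.mul_identity_mem hu 1) a)
  map_smul' c a := by simp
  map_zero' := by simp
  map_add' a b := by simp
  map_mul' a b := by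
    rw [← hε]
    congr 1
    apply incl_injective
    rw [incl_mul, incl_retract, incl_retract, incl_retract, mul_assoc a (u 1 : A),
      h𝒜.identity_comm hu, mul_assoc b, h𝒜.identity_mul_identity hu, mul_assoc]

variable {ε : UnitalSub (𝒜 1) (u 1) (hu 1) →ₗ[ℂ] ℂ} (hε : ∀ a b, ε (a * b) = ε a * ε b)

theorem extendChar_apply (a : A) :
    h𝒜.extendChar hu ε hε a = ε (retract (h𝒜.mul_identity_mem hu 1) a) := rfl

theorem extendChar_incl (a : UnitalSub (𝒜 1) (u 1) (hu 1)) :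
    h𝒜.extendChar hu ε hε (incl a) = ε a := by
  rw [extendChar_apply, retract_incl]

theorem extendChar_comp_mulRight :
    (h𝒜.extendChar hu ε hε : A →ₗ[ℂ] ℂ) ∘ₗ LinearMap.mulRight ℂ (u 1 : A) =
      (h𝒜.extendChar hu ε hε : A →ₗ[ℂ] ℂ) := by
  ext a
  change h𝒜.extendChar hu ε hε (a * u 1) = h𝒜.extendChar hu ε hε a
  rw [← incl_retract (hu := hu 1) (h𝒜.mul_identity_mem hu 1), extendChar_incl, extendChar_apply]

theorem comulAt_one_one (a : A) : comulAt Δ (u 1 ⊗ₜ u 1) a = TensorProduct.map incl incl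
    (h𝒜.comulOne hu (retract (h𝒜.mul_identity_mem hu 1) a)) := by
  rw [h𝒜.map_incl_comulOne hu, incl_retract, h𝒜.comulAt_mul_identity hu (one_mul 1).symm]

theorem lid_rTensor_extendChar_one
    (hl : ∀ a, TensorProduct.lid ℂ _ (ε.rTensor _ (h𝒜.comulOne hu a)) = a) (a : A) :
    TensorProduct.lid ℂ A ((h𝒜.extendChar hu ε hε : A →ₗ[ℂ] ℂ).rTensor A
      (comulAt Δ (u 1 ⊗ₜ u 1) a)) = a * u 1 := by
  rw [h𝒜.comulAt_one_one hu, ← incl_retract (hu := hu 1) (h𝒜.mul_identity_mem hu 1)]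
  conv_rhs => rw [← hl (retract (h𝒜.mul_identity_mem hu 1) a)]
  induction h𝒜.comulOne hu (retract (h𝒜.mul_identity_mem hu 1) a)
    using TensorProduct.induction_on with
  | zero => simp
  | add x y hx hy => simp only [map_add, hx, hy]
  | tmul c d => simp [extendChar_incl]

theorem rid_lTensor_extendChar_one
    (hr : ∀ a, TensorProduct.rid ℂ _ (ε.lTensor _ (h𝒜.comulOne hu a)) = a) (a : A) :
    TensorProduct.rid ℂ A ((h𝒜.extendChar hu ε hε : A →ₗ[ℂ] ℂ).lTensor A
      (comulAt Δ (u 1 ⊗ₜ u 1) a)) = a * u 1 := by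
  rw [h𝒜.comulAt_one_one hu, ← incl_retract (hu := hu 1) (h𝒜.mul_identity_mem hu 1)]
  conv_rhs => rw [← hr (retract (h𝒜.mul_identity_mem hu 1) a)]
  induction h𝒜.comulOne hu (retract (h𝒜.mul_identity_mem hu 1) a)
    using TensorProduct.induction_on with
  | zero => simp
  | add x y hx hy => simp only [map_add, hx, hy]
  | tmul c d => simp [extendChar_incl]

/-- The counit law of A_e propagates to A_q: with a' the left side, coassociativity and the case q =
e give Δ_{e,q}(a') = Δ_{e,q}(a), and Δ_{e,q} is injective on A_q. -/
theorem lid_rTensor_extendChar (hΔ : IsMultiplierHopfAlgebra Δ)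
    (hl : ∀ a, TensorProduct.lid ℂ _ (ε.rTensor _ (h𝒜.comulOne hu a)) = a) (q : G) (a : A) :
    TensorProduct.lid ℂ A ((h𝒜.extendChar hu ε hε : A →ₗ[ℂ] ℂ).rTensor A
      (comulAt Δ (u 1 ⊗ₜ u q) a)) = a * u q := by
  set E := (h𝒜.extendChar hu ε hε : A →ₗ[ℂ] ℂ) with hE
  have hmap : comulAt Δ (u 1 ⊗ₜ u q) a = TensorProduct.map (LinearMap.mulRight ℂ (u 1 : A))
      (LinearMap.mulRight ℂ (u q : A)) (comulAt Δ (u 1 ⊗ₜ u q) a) := by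
    rw [← mul_tmul_eq_map, h𝒜.comulAt_mul_tmul_identity hu]
  have hmem : TensorProduct.lid ℂ A (E.rTensor A (comulAt Δ (u 1 ⊗ₜ u q) a)) ∈ 𝒜 q := by
    rw [hmap, lid_rTensor_map_mulRight]
    exact h𝒜.mul_identity_mem hu q _
  have h1 : ∀ x : A ⊗[ℂ] A, TensorProduct.lid ℂ (A ⊗[ℂ] A) (E.rTensor (A ⊗[ℂ] A)
      (TensorProduct.assoc ℂ A A A ((comulAt Δ (u 1 ⊗ₜ u 1)).rTensor A x))) =
      (LinearMap.mulRight ℂ (u 1 : A)).rTensor A x := by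
    intro x
    induction x using TensorProduct.induction_on with
    | zero => simp
    | add x y hx hy => simp only [map_add, hx, hy]
    | tmul c d =>
      rw [LinearMap.rTensor_tmul, LinearMap.rTensor_tmul, LinearMap.mulRight_apply,
        ← h𝒜.lid_rTensor_extendChar_one hu hε hl c, ← hE]
      induction comulAt Δ (u 1 ⊗ₜ u 1) c using TensorProduct.induction_on with
      | zero => simp
      | add x y hx hy => simp only [map_add, TensorProduct.add_tmul, hx, hy]
      | tmul s t => simp [TensorProduct.smul_tmul']
  have h2 : ∀ x : A ⊗[ℂ] A, TensorProduct.lid ℂ (A ⊗[ℂ] A) (E.rTensor (A ⊗[ℂ] A)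
      ((comulAt Δ (u 1 ⊗ₜ u q)).lTensor A x)) =
      comulAt Δ (u 1 ⊗ₜ u q) (TensorProduct.lid ℂ A (E.rTensor A x)) := by
    intro x
    induction x using TensorProduct.induction_on with
    | zero => simp
    | add x y hx hy => simp only [map_add, hx, hy]
    | tmul c d => simp
  have h3 : (LinearMap.mulRight ℂ (u 1 : A)).rTensor A (comulAt Δ (u 1 ⊗ₜ u q) a) =
      comulAt Δ (u 1 ⊗ₜ u q) a := by
    conv_lhs => rw [hmap, ← LinearMap.comp_apply, LinearMap.rTensor_comp_map,
      ← LinearMap.mulRight_mul, h𝒜.identity_mul_identity hu]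
    exact hmap.symm
  have h4 := h𝒜.comulAt_coassoc hu hΔ.toIsComultiplication (one_mul 1).symm (one_mul q).symm a
  have h5 := congr(TensorProduct.lid ℂ (A ⊗[ℂ] A) (E.rTensor (A ⊗[ℂ] A) $h4))
  rw [h1, h2, h3] at h5
  rw [← sub_eq_zero]
  refine h𝒜.comulAt_one_left_injOn hu hΔ q (sub_mem hmem (h𝒜.mul_identity_mem hu q a)) ?_
  rw [map_sub, ← h5, h𝒜.comulAt_mul_identity hu (one_mul q).symm, sub_self]

theorem rid_lTensor_extendChar (hΔ : IsMultiplierHopfAlgebra Δ)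
    (hr : ∀ a, TensorProduct.rid ℂ _ (ε.lTensor _ (h𝒜.comulOne hu a)) = a) (q : G) (a : A) :
    TensorProduct.rid ℂ A ((h𝒜.extendChar hu ε hε : A →ₗ[ℂ] ℂ).lTensor A
      (comulAt Δ (u q ⊗ₜ u 1) a)) = a * u q := by
  set E := (h𝒜.extendChar hu ε hε : A →ₗ[ℂ] ℂ) with hE
  have hmap : comulAt Δ (u q ⊗ₜ u 1) a = TensorProduct.map (LinearMap.mulRight ℂ (u q : A))
      (LinearMap.mulRight ℂ (u 1 : A)) (comulAt Δ (u q ⊗ₜ u 1) a) := by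
    rw [← mul_tmul_eq_map, h𝒜.comulAt_mul_tmul_identity hu]
  have hmem : TensorProduct.rid ℂ A (E.lTensor A (comulAt Δ (u q ⊗ₜ u 1) a)) ∈ 𝒜 q := by
    rw [hmap, rid_lTensor_map_mulRight]
    exact h𝒜.mul_identity_mem hu q _
  have h1 : ∀ x : A ⊗[ℂ] A, ((TensorProduct.rid ℂ A).toLinearMap ∘ₗ E.lTensor A).lTensor A
      (TensorProduct.assoc ℂ A A A ((comulAt Δ (u q ⊗ₜ u 1)).rTensor A x)) =
      comulAt Δ (u q ⊗ₜ u 1) (TensorProduct.rid ℂ A (E.lTensor A x)) := by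
    intro x
    induction x using TensorProduct.induction_on with
    | zero => simp
    | add x y hx hy => simp only [map_add, hx, hy]
    | tmul c d =>
      rw [LinearMap.rTensor_tmul, LinearMap.lTensor_tmul, TensorProduct.rid_tmul, map_smul]
      induction comulAt Δ (u q ⊗ₜ u 1) c using TensorProduct.induction_on with
      | zero => simp
      | add x y hx hy => simp only [map_add, TensorProduct.add_tmul, smul_add, hx, hy]
      | tmul s t => simp
  have h2 : ∀ x : A ⊗[ℂ] A, ((TensorProduct.rid ℂ A).toLinearMap ∘ₗ E.lTensor A).lTensor A
      ((comulAt Δ (u 1 ⊗ₜ u 1)).lTensor A x) =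
      (LinearMap.mulRight ℂ (u 1 : A)).lTensor A x := by
    intro x
    rw [← LinearMap.lTensor_comp_apply]
    congr 2
    ext a
    exact h𝒜.rid_lTensor_extendChar_one hu hε hr a
  have h3 : (LinearMap.mulRight ℂ (u 1 : A)).lTensor A (comulAt Δ (u q ⊗ₜ u 1) a) =
      comulAt Δ (u q ⊗ₜ u 1) a := by
    conv_lhs => rw [hmap, ← LinearMap.comp_apply, LinearMap.lTensor_comp_map,
      ← LinearMap.mulRight_mul, h𝒜.identity_mul_identity hu]
    exact hmap.symm
  have h4 := h𝒜.comulAt_coassoc hu hΔ.toIsComultiplication (mul_one q).symm (one_mul 1).symm a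
  have h5 := congr(((TensorProduct.rid ℂ A).toLinearMap ∘ₗ E.lTensor A).lTensor A $h4)
  rw [h1, h2, h3] at h5
  rw [← sub_eq_zero]
  refine h𝒜.comulAt_one_right_injOn hu hΔ q (sub_mem hmem (h𝒜.mul_identity_mem hu q a)) ?_
  rw [map_sub, h5, h𝒜.comulAt_mul_identity hu (mul_one q).symm, sub_self]

/-- The counit of the component of the identity of `G` extends by zero to the counit of `(A, Δ)`. -/
theorem isCounit_extendChar (hΔ : IsMultiplierHopfAlgebra Δ)
    (hl : ∀ a, TensorProduct.lid ℂ _ (ε.rTensor _ (h𝒜.comulOne hu a)) = a)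
    (hr : ∀ a, TensorProduct.rid ℂ _ (ε.lTensor _ (h𝒜.comulOne hu a)) = a) :
    IsCounit Δ (h𝒜.extendChar hu ε hε) where
  left a b := by
    obtain ⟨T, hT⟩ := hΔ.bijective_left
    refine ⟨T (a ⊗ₜ b), hT a b, ?_⟩
    induction b using h𝒜.induction_components with
    | hP q b hb =>
      -- As b = 1_q b, it is enough to treat Δ(a)(1 ⊗ 1_q). The extended ε ignores multiplication by
      -- 1_e on the first leg, so this may be cut to Δ_{e,q}(a).
      have h1 : T (a ⊗ₜ b) = (LinearMap.mulRight ℂ b).lTensor A (T (a ⊗ₜ (u q : A))) := by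
        apply h𝒜.of_injective hu
        rw [hT, ← right_oneTmul, ← of_mul, hT, mul_assoc, oneTmul_mul_oneTmul, (hu q).mul_eq hb]
      have h2 := h𝒜.mul_tmul_identity_of_eq_comul_mul hu 1 q (hT a (u q))
      have h3 := h𝒜.lid_rTensor_extendChar hu hε hΔ hl q a
      rw [← h2, mul_tmul_eq_map, lid_rTensor_map_mulRight, extendChar_comp_mulRight] at h3
      rw [h1, lid_rTensor_lTensor_mulRight]
      conv_lhs => rw [← (hu q).mul_eq hb, ← mul_assoc, h3, mul_assoc, (hu q).mul_eq hb]
    | h0 => simp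
    | hadd b c hb hc => rw [TensorProduct.tmul_add, map_add, map_add, map_add, hb, hc, mul_add]
  right a b := by
    obtain ⟨T, hT⟩ := hΔ.bijective_right
    refine ⟨T (a ⊗ₜ b), hT a b, ?_⟩
    induction a using h𝒜.induction_components with
    | hP q a ha =>
      have h1 : T (a ⊗ₜ b) = (LinearMap.mulLeft ℂ a).rTensor A (T ((u q : A) ⊗ₜ b)) := by
        apply h𝒜.of_injective hu
        rw [hT, ← left_tmulOne, ← mul_of, hT, ← mul_assoc, tmulOne_mul_tmulOne, (hu q).eq_mul ha]
      have h2 := h𝒜.mul_tmul_identity_of_eq_mul_comul hu q 1 (hT (u q) b)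
      have h3 := h𝒜.rid_lTensor_extendChar hu hε hΔ hr q b
      rw [← h2, mul_tmul_eq_map, rid_lTensor_map_mulRight, extendChar_comp_mulRight] at h3
      rw [h1, rid_lTensor_rTensor_mulLeft]
      conv_lhs => rw [← (hu q).eq_mul ha, mul_assoc, h𝒜.identity_comm hu, h3,
        ← h𝒜.identity_comm hu, ← mul_assoc, (hu q).eq_mul ha]
    | h0 => simp
    | hadd b c hb hc => rw [TensorProduct.add_tmul, map_add, map_add, map_add, hb, hc, add_mul]

end IsCograded

end Counit

end MultiplierHopf

end

open MultiplierHopf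

theorem proposition3p3 {G : Type*} [Group G]
    {A : Type*} [NonUnitalRing A] [Module ℂ A] [IsScalarTower ℂ A A] [SMulCommClass ℂ A A]
    (Δ : A →ₙₐ[ℂ] Multiplier (A ⊗[ℂ] A)) (hΔ : IsRegularMultiplierHopfAlgebra Δ)
    (𝒜 : G → NonUnitalSubalgebra ℂ A) (h𝒜 : IsCograded Δ 𝒜)
    (hfin : ∀ p, FiniteDimensional ℂ (𝒜 p))
    (u : ∀ p, 𝒜 p) (hu : ∀ p, IsIdentity (𝒜 p) (u p)) :
    IsDiscreteType Δ ∧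
    ∃ _H : HopfAlgebra ℂ (UnitalSub (𝒜 1) (u 1) (hu 1)),
      IsComponentHopfAlgebra Δ (𝒜 1) (u 1) (hu 1) ∧
      (∃ h : UnitalSub (𝒜 1) (u 1) (hu 1), IsHopfLeftCointegral h) ∧
      ∀ h : UnitalSub (𝒜 1) (u 1) (hu 1), IsHopfLeftCointegral h → IsLeftCointegral Δ h.val := by
  have hΔ' := hΔ.toIsMultiplierHopfAlgebra
  have hfd : FiniteDimensional ℂ (UnitalSub (𝒜 1) (u 1) (hu 1)) := hfin 1
  have : Nontrivial (UnitalSub (𝒜 1) (u 1) (hu 1)) :=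
    ⟨1, 0, fun h => h𝒜.identity_ne_zero hu 1 congr(UnitalSub.val $h)⟩
  have hδ := h𝒜.isGaloisComul_comulOne hu hΔ'.toIsComultiplication
  have hcounit := h𝒜.isCounit_extendChar hu hδ.counit_mul hΔ' hδ.lid_rTensor_counit
    hδ.rid_lTensor_counit
  have hcoint : ∀ h : UnitalSub (𝒜 1) (u 1) (hu 1), h ≠ 0 →
      (∀ a, a * h = hδ.counit a • h) → IsLeftCointegral Δ h.val := by
    intro h hne hh
    refine ⟨fun h0 => hne (UnitalSub.incl_injective h0), _, hcounit, fun a => ?_⟩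
    have := congr(UnitalSub.incl $(hh (UnitalSub.retract (h𝒜.mul_identity_mem hu 1) a)))
    rw [UnitalSub.incl_mul, UnitalSub.incl_retract, mul_assoc, UnitalSub.identity_mul_incl,
      map_smul] at this
    exact this
  -- The counit of this structure is `hδ.counit` by definition, so `hcoint` applies to its
  -- cointegrals directly.
  let H := hδ.hopfAlgebra
  obtain ⟨h, hne, hh⟩ := exists_ne_zero_forall_mul_eq_counit_smul (k := ℂ)
    (H := UnitalSub (𝒜 1) (u 1) (hu 1))
  refine ⟨⟨hΔ', _, hcoint h hne hh⟩, H, ⟨UnitalSub.incl, fun _ => rfl, fun b => ?_⟩,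
    ⟨h, hne, hh⟩, fun h hh => hcoint h hh.1 hh.2⟩
  rw [Multiplier.mul_of]
  exact congrArg _ (h𝒜.map_incl_comulOne hu b)
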